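/- Let $(X,d)$ be a complete metric space equipped with a Borel measure $\mu$ such that $0<\mu(B)<\infty$ for all balls $B$. Assume that $\mu$ is doubling, i.e. $\mu(B(x,2r))\le C_\mu\,\mu(B(x,r))$ for all $x\in X$, $r>0$. Fix $1\le p<\infty$ and assume that $X$ supports a $p$-Poincaré inequality: there are $C>0$ and $\lambda\ge 1$ such that for all balls $B$, all $u$ in the Newtonian space $N^{1,p}(X)$ and all upper gradients $g\in L^p(X)$ of $u$, $$\frac1{\mu(B)}\int_B|u-u_B|\,d\mu\le C\,\mathrm{diam}(B)\Bigl(\frac1{\mu(\lambda B)}\int_{\lambda B}g^p\,d\mu\Bigr)^{1/p},\qquad u_B=\frac1{\mu(B)}\int_B u\,d\mu .$$ Let $\Omega\subsetneq X$ be a bounded nonempty connected open set. Definitions. Boundaries and closures are taken in $X$. * A bounded connected set $E\subsetneq\Omega$ is *acceptable* if $\overline E\cap\partial\Omega\neq\emptyset$. * A sequence $\{E_k\}_{k=1}^\infty$ of acceptable sets is a *chain* if, for all $k$, $E_{k+1}\subset E_k$ and $\mathrm{dist}(\Omega\cap\partial E_{k+1},\Omega\cap\partial E_k)>0$, and if its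 *impression* $\bigcap_k\overline{E}_k$ is contained in $\partial\Omega$. * A chain $\{E_k\}$ *divides* a chain $\{F_k\}$ if for each $k$ there is $l$ with $E_l\subset F_k$. Two chains are equivalent if they divide each other. An *end* $[E_k]$ is an equivalence class of chains; its impression $I[E_k]$ is the impression of any representative, and division of ends is division of representatives. A *prime end* is an end that is not divisible by any other end. * For a family $\Gamma$ of nonconstant rectifiable curves, $\mathrm{Mod}_p(\Gamma)=\inf_\rho\int_X\rho^p\,d\mu$, where the infimum is over all Borel $\rho\ge0$ with $\int_\gamma\rho\,ds\ge1$ for all $\gamma\in\Gamma$; and $\mathrm{Mod}_p(E,F,\Omega)$ is the modulus of the family of nonconstant rectifiable curves in $\Omega$ starting in $E$ and ending in $F$. A chain $\{E_k\}$ is a *$\mathrm{Mod}_p$-chain* if $\lim_{k\to\infty}\mathrm{Mod}_p(E_k,K,\Omega)=0$ for every compact $K\subset\Omega$. A *$\mathrm{Mod}_p$-end* is an end represented by some $\mathrm{Mod}_p$-chain, and a *$\mathrm{Mod}_p$-prime end* is a $\mathrm{Mod}_p$-end that is not divisible by any other $\mathrm{Mod}_p$-end. * A point $x\in\partial\Omega$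 is *accessible* if there is a (possibly nonrectifiable) continuous curve $\gamma:[0,1]\to X$ with $\gamma(1)=x$ and $\gamma([0,1))\subset\Omega$. * For $x\in X$, $Q(x)$ is the set of all $q>0$ for which there are constants $C_q,R_q>0$ such that $\dfrac{\mu(B(x,r))}{\mu(B(x,R))}\le C_q\Bigl(\dfrac rR\Bigr)^q$ for all $0<r\le R\le R_q$. Theorem. Let $x\in\partial\Omega$. Then the following are equivalent: 1. $x$ is accessible; 2. there is an end $[E_k]$ with $I[E_k]=\{x\}$; 3. there is a prime end $[E_k]$ with $I[E_k]=\{x\}$. If moreover $p\in Q(x)$ and $Q(x)\ne(0,1]$, then the following statements are also equivalent to the statements above: 4. there is a $\mathrm{Mod}_p$-end $[E_k]$ with $I[E_k]=\{x\}$; 5. there is a $\mathrm{Mod}_p$-prime end $[E_k]$ with $I[E_k]=\{x\}$. -/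

import Mathlib

open Set Filter Topology MeasureTheory
open scoped ENNReal NNReal

noncomputable section

namespace PrimeEnds

/-! ### Curves, modulus, Newtonian functions and the Poincaré inequality -/

section Curves

/-- A nonconstant rectifiable curve `γ : [0, l] → X`, parameterized by arc length
(so `0 < l < ∞`, and the length of `γ` on every `[s, t] ⊆ [0, l]` is `t - s`).
The values of `toFun` outside `[0, l]` play no role. -/
structure RectCurve (X : Type*) [MetricSpace X] where
  toFun : ℝ → X
  length : ℝ
  length_pos : 0 < length
  unitSpeed : HasUnitSpeedOn toFun (Icc 0 length)

variable {X : Type*} [MetricSpace X]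

/-- The line integral `∫_γ ρ ds` with respect to arc length. -/
def RectCurve.lineIntegral (γ : RectCurve X) (ρ : X → ℝ≥0∞) : ℝ≥0∞ :=
  ∫⁻ t in Icc 0 γ.length, ρ (γ.toFun t)

variable [MeasurableSpace X]

/-- The `p`-modulus of a family `Γ` of nonconstant rectifiable curves. -/
def modulus (μ : Measure X) (p : ℝ) (Γ : Set (RectCurve X)) : ℝ≥0∞ :=
  ⨅ (ρ : X → ℝ≥0∞) (_ : Measurable ρ) (_ : ∀ γ ∈ Γ, 1 ≤ γ.lineIntegral ρ),
    ∫⁻ y, ρ y ^ p ∂μ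

/-- The family `Γ(E, F, U)` of nonconstant rectifiable curves in `U` from `E` to `F`. -/
def connectingCurves (E F U : Set X) : Set (RectCurve X) :=
  {γ | γ.toFun 0 ∈ E ∧ γ.toFun γ.length ∈ F ∧ ∀ t ∈ Icc 0 γ.length, γ.toFun t ∈ U}

/-- `g` is an upper gradient of the extended real-valued function `u`. -/
def IsUpperGradient (g : X → ℝ≥0∞) (u : X → EReal) : Prop :=
  Measurable g ∧ ∀ γ : RectCurve X,
    ((u (γ.toFun 0)).abs ≠ ⊤ ∧ (u (γ.toFun γ.length)).abs ≠ ⊤ →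
      (u (γ.toFun 0) - u (γ.toFun γ.length)).abs ≤ γ.lineIntegral g) ∧
    (¬ ((u (γ.toFun 0)).abs ≠ ⊤ ∧ (u (γ.toFun γ.length)).abs ≠ ⊤) →
      γ.lineIntegral g = ⊤)

/-- The Newtonian norm `‖u‖_{N^{1,p}(X)}`. -/
def newtonianNorm (μ : Measure X) (p : ℝ) (u : X → EReal) : ℝ≥0∞ :=
  ((∫⁻ y, (u y).abs ^ p ∂μ) +
    ⨅ (g : X → ℝ≥0∞) (_ : IsUpperGradient g u), ∫⁻ y, g y ^ p ∂μ) ^ (1 / p)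

/-- `u` belongs to the Newtonian space `N^{1,p}(X)`. -/
def MemNewtonian (μ : Measure X) (p : ℝ) (u : X → EReal) : Prop :=
  AEMeasurable u μ ∧ newtonianNorm μ p u < ⊤

/-- `X` supports a `p`-Poincaré inequality: there are `C > 0` and `lam ≥ 1` such that
`⨍_B |u - u_B| dμ ≤ C diam(B) (⨍_{lam B} g ^ p dμ)^{1/p}` for all balls `B`, all
`u ∈ N^{1,p}(X)` and all upper gradients `g ∈ L^p(X)` of `u`. (As the minimal `p`-weak upper
gradient `g_u` of `u` satisfies `g_u ≤ g` a.e. for each such `g`, and is an `L^p`-limit of such `g`,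
this is the same as the inequality with `g_u` in place of `g`.) Functions in `N^{1,p}(X)` are
finite a.e., so that `toReal` changes them on a null set only. -/
def SupportsPoincare (μ : Measure X) (p : ℝ) : Prop :=
  ∃ C : ℝ≥0, 0 < C ∧ ∃ lam : ℝ, 1 ≤ lam ∧
    ∀ (x : X) (r : ℝ), 0 < r → ∀ u : X → EReal, MemNewtonian μ p u →
      ∀ g : X → ℝ≥0∞, IsUpperGradient g u → ∫⁻ y, g y ^ p ∂μ < ⊤ →
        ⨍⁻ y in Metric.ball x r,
            ‖(u y).toReal - ⨍ z in Metric.ball x r, (u z).toReal ∂μ‖ₑ ∂μ ≤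
          C * Metric.ediam (Metric.ball x r) *
            (⨍⁻ y in Metric.ball x (lam * r), g y ^ p ∂μ) ^ (1 / p)

/-- The measure `μ` is (globally) doubling. -/
def IsDoubling (μ : Measure X) : Prop :=
  ∃ C : ℝ≥0, 0 < C ∧ ∀ (x : X) (r : ℝ), 0 < r →
    μ (Metric.ball x (2 * r)) ≤ C * μ (Metric.ball x r)

/-- The pointwise dimension set `Q(x)`. -/
def dimSet (μ : Measure X) (x : X) : Set ℝ :=
  {q | 0 < q ∧ ∃ C > 0, ∃ R₀ > 0, ∀ r R : ℝ, 0 < r → r ≤ R → R ≤ R₀ →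
    μ.real (Metric.ball x r) / μ.real (Metric.ball x R) ≤ C * (r / R) ^ q}

end Curves

/-! ### Chains, ends and prime ends -/

section Ends

variable {X : Type*} [MetricSpace X]

/-- The distance between two sets (`∞` if one of them is empty). -/
def setDist (A B : Set X) : ℝ≥0∞ := ⨅ (a ∈ A) (b ∈ B), edist a b

/-- `E` is an acceptable subset of `Ω`. -/
structure IsAcceptable (Ω E : Set X) : Prop where
  bounded : Bornology.IsBounded E
  connected : IsConnected E
  ssubset : E ⊂ Ω
  meets : (closure E ∩ frontier Ω).Nonempty

/-- A chain in `Ω`. The sequence is indexed by `0, 1, 2, …`. -/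
structure Chain (Ω : Set X) where
  sets : ℕ → Set X
  acceptable : ∀ k, IsAcceptable Ω (sets k)
  subset : ∀ k, sets (k + 1) ⊆ sets k
  dist_pos : ∀ k, 0 < setDist (Ω ∩ frontier (sets (k + 1))) (Ω ∩ frontier (sets k))
  impression_subset : ⋂ k, closure (sets k) ⊆ frontier Ω

variable {Ω : Set X}

namespace Chain

/-- The impression of a chain. -/
def impression (E : Chain Ω) : Set X := ⋂ k, closure (E.sets k)

/-- The chain `E` divides the chain `F`. -/
def Divides (E F : Chain Ω) : Prop := ∀ k, ∃ l, E.sets l ⊆ F.sets k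

theorem Divides.refl (E : Chain Ω) : E.Divides E := fun k => ⟨k, Subset.rfl⟩

theorem Divides.trans {E F G : Chain Ω} (h : E.Divides F) (h' : F.Divides G) :
    E.Divides G := fun k => by
  obtain ⟨l, hl⟩ := h' k
  obtain ⟨m, hm⟩ := h l
  exact ⟨m, hm.trans hl⟩

theorem Divides.impression_subset {E F : Chain Ω} (h : E.Divides F) :
    E.impression ⊆ F.impression := fun _ hx => mem_iInter.2 fun k => by
  obtain ⟨l, hl⟩ := h k
  exact closure_mono hl (mem_iInter.1 hx l)

/-- Two chains are equivalent if they divide each other. -/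
instance setoid (Ω : Set X) : Setoid (Chain Ω) where
  r E F := E.Divides F ∧ F.Divides E
  iseqv :=
    ⟨fun E => ⟨.refl E, .refl E⟩, fun h => ⟨h.2, h.1⟩,
      fun h h' => ⟨h.1.trans h'.1, h'.2.trans h.2⟩⟩

/-- `E` is a `Mod_p`-chain. -/
def IsModChain [MeasurableSpace X] (μ : Measure X) (p : ℝ) (E : Chain Ω) : Prop :=
  ∀ K : Set X, IsCompact K → K ⊆ Ω →
    Tendsto (fun k => modulus μ p (connectingCurves (E.sets k) K Ω)) atTop (𝓝 0)

end Chain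

/-- An end of `Ω`: an equivalence class of chains. -/
def End (Ω : Set X) : Type _ := Quotient (Chain.setoid Ω)

namespace End

/-- The impression of an end, i.e. of any representing chain. -/
def impression (e : End Ω) : Set X :=
  Quotient.lift Chain.impression
    (fun E F (h : E.Divides F ∧ F.Divides E) =>
      h.1.impression_subset.antisymm h.2.impression_subset) e

/-- Division of ends, i.e. of any representing chains. -/
def Divides (e f : End Ω) : Prop :=
  Quotient.lift₂ Chain.Divides
    (fun E F E' F' (h : E.Divides E' ∧ E'.Divides E) (h' : F.Divides F' ∧ F'.Divides F) => propext
      ⟨fun H => (h.2.trans H).trans h'.1, fun H => (h.1.trans H).trans h'.2⟩) e f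

/-- A prime end is an end that is not divisible by any other end. -/
def IsPrime (e : End Ω) : Prop := ∀ f : End Ω, f.Divides e → f = e

/-- A `Mod_p`-end is an end represented by some `Mod_p`-chain. -/
def IsModEnd [MeasurableSpace X] (μ : Measure X) (p : ℝ) (e : End Ω) : Prop :=
  ∃ E : Chain Ω, E.IsModChain μ p ∧ (⟦E⟧ : Quotient (Chain.setoid Ω)) = e

/-- A `Mod_p`-prime end is a `Mod_p`-end that is not divisible by any other `Mod_p`-end. -/
def IsModPrime [MeasurableSpace X] (μ : Measure X) (p : ℝ) (e : End Ω) : Prop :=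
  e.IsModEnd μ p ∧ ∀ f : End Ω, f.IsModEnd μ p → f.Divides e → f = e

end End

/-- `x` is accessible from `Ω`: it is the end point of a (possibly nonrectifiable) curve
`γ : [0, 1] → X` with `γ([0, 1)) ⊆ Ω`. -/
def IsAccessible (Ω : Set X) (x : X) : Prop :=
  ∃ γ : ℝ → X, ContinuousOn γ (Icc 0 1) ∧ γ 1 = x ∧ ∀ t ∈ Ico (0 : ℝ) 1, γ t ∈ Ω

end Ends

end PrimeEnds

end

/-! Completeness and doubling make `X` proper; the Poincaré inequality makes it locally path
connected. The rest is topology plus one modulus estimate.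

Local connectivity (`SupportsPoincare.locallyPathConnectedSpace`): the length distance along
`ε`-discrete curves from `y`, suitably cut off, is `1`-Lipschitz at scale `ε` and has an upper
gradient bounded by `1`. Poincaré and a telescoping sum over balls give a Lipschitz constant
independent of `ε`. Hence `y` and `z` are joined by discrete curves of length comparable to `d(y,
z)` for every `ε`, and a limit as `ε → 0` is a true curve.

Accessibility and ends: if a curve in `Ω` ends at `x`, the components of `Ω ∩ B(x, r_k)` containing
its tails form a chain. Conversely, the sets of a chain with impression `{x}` shrink to `x`, and
points chosen in them are joined by paths inside `Ω` and ever smaller balls.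

Primality is automatic for a singleton impression (`Chain.divides_of_impression_eq_singleton`): a
small connected set cannot reach both of two boundaries a positive distance apart.

So is the `Mod_p` condition (`exists_modulus_le`): for `p > 1` a test function spread over many
dyadic annuli makes the modulus small; for `p = 1` the hypothesis on `Q(x)` gives an exponent `q >
1`, and one annulus suffices. -/

namespace PrimeEnds

/-! ### Modulus of curve families crossing annuli -/

section Modulus

variable {X : Type*} [MetricSpace X]

theorem RectCurve.lipschitzOnWith (γ : RectCurve X) :
    LipschitzOnWith 1 γ.toFun (Icc 0 γ.length) := by
  have key : ∀ s ∈ Icc 0 γ.length, ∀ t ∈ Icc 0 γ.length, s ≤ t →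
      edist (γ.toFun s) (γ.toFun t) ≤ edist s t := by
    intro s hs t ht hst
    refine (eVariationOn.edist_le γ.toFun (s := Icc 0 γ.length ∩ Icc s t)
      ⟨hs, left_mem_Icc.2 hst⟩ ⟨ht, right_mem_Icc.2 hst⟩).trans ?_
    rw [γ.unitSpeed hs ht, edist_comm s t, edist_dist, Real.dist_eq, abs_of_nonneg (by linarith)]
    simp
  intro s hs t ht
  rw [ENNReal.coe_one, one_mul]
  rcases le_total s t with h | h
  · exact key s hs t ht h
  · rw [edist_comm, edist_comm s]
    exact key t ht s hs h

/-- The image of an interval under a `1`-Lipschitz function covers all intermediate values. -/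
theorem restrict_uIcc_le_map {l : ℝ} (hl : 0 ≤ l) {h : ℝ → ℝ}
    (hh : LipschitzOnWith 1 h (Icc 0 l)) :
    (volume : Measure ℝ).restrict (uIcc (h 0) (h l)) ≤
      (volume.restrict (Icc 0 l)).map h := by
  have hc := hh.continuousOn
  refine Measure.le_iff.2 fun S hS => ?_
  rw [Measure.restrict_apply hS,
    Measure.map_apply_of_aemeasurable (hc.aemeasurable measurableSet_Icc) hS]
  have hsub : S ∩ uIcc (h 0) (h l) ⊆ h '' (h ⁻¹' S ∩ Icc 0 l) := by
    rintro c ⟨hcS, hc'⟩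
    have := intermediate_value_uIcc (a := (0 : ℝ)) (b := l) (by rwa [uIcc_of_le hl])
      hc'
    rw [uIcc_of_le hl] at this
    obtain ⟨t, ht, rfl⟩ := this
    exact ⟨t, ⟨hcS, ht⟩, rfl⟩
  -- `1`-Lipschitz maps do not increase one-dimensional Hausdorff measure, which on `ℝ` is Lebesgue
  -- measure.
  have hL : LipschitzOnWith 1 h (h ⁻¹' S ∩ Icc 0 l) := hh.mono inter_subset_right
  have := hL.hausdorffMeasure_image_le (d := 1) zero_le_one
  rw [hausdorffMeasure_real] at this
  calc volume (S ∩ uIcc (h 0) (h l)) ≤ volume (h '' (h ⁻¹' S ∩ Icc 0 l)) := measure_mono hsub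
    _ ≤ volume (h ⁻¹' S ∩ Icc 0 l) := by simpa using this
    _ ≤ _ := Measure.le_restrict_apply _ _

theorem lintegral_uIcc_le {l : ℝ} (hl : 0 ≤ l) {h : ℝ → ℝ}
    (hh : LipschitzOnWith 1 h (Icc 0 l)) {F : ℝ → ℝ≥0∞} (hF : Measurable F) :
    ∫⁻ s in uIcc (h 0) (h l), F s ≤ ∫⁻ t in Icc 0 l, F (h t) := by
  rw [← lintegral_map' hF.aemeasurable (hh.continuousOn.aemeasurable measurableSet_Icc)]
  exact lintegral_mono' (restrict_uIcc_le_map hl hh) le_rfl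

/-- The step function with value `(n 2 ^ j s)⁻¹` on `[2 ^ j s, 2 ^ (j + 1) s)`, `j < n`. -/
noncomputable def dyadicWeight (s : ℝ) (n : ℕ) (t : ℝ) : ℝ≥0∞ :=
  ∑ j ∈ Finset.range n,
    (Ico (2 ^ j * s) (2 ^ (j + 1) * s)).indicator
      (fun _ => ENNReal.ofReal ((n * (2 ^ j * s))⁻¹)) t

theorem measurable_dyadicWeight (s : ℝ) (n : ℕ) : Measurable (dyadicWeight s n) :=
  Finset.measurable_fun_sum _ fun _ _ => measurable_const.indicator measurableSet_Ico

/-- The `j`-th interval has length `2 ^ j * s`, so each of the `n` steps contributes exactly `1 /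
n`. -/
theorem one_le_lintegral_dyadicWeight {s a b : ℝ} (hs : 0 < s) {n : ℕ} (hn : n ≠ 0)
    (ha : a ≤ s) (hb : 2 ^ n * s ≤ b) : 1 ≤ ∫⁻ t in uIcc a b, dyadicWeight s n t := by
  unfold dyadicWeight
  rw [lintegral_finsetSum _ fun _ _ => measurable_const.indicator measurableSet_Ico]
  have h : ∀ j ∈ Finset.range n, ENNReal.ofReal ((n : ℝ)⁻¹) ≤
      ∫⁻ t in uIcc a b, (Ico (2 ^ j * s) (2 ^ (j + 1) * s)).indicator
        (fun _ => ENNReal.ofReal ((n * (2 ^ j * s))⁻¹)) t := by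
    intro j hj
    have hj' : (2 : ℝ) ^ (j + 1) ≤ 2 ^ n :=
      pow_le_pow_right₀ one_le_two (Finset.mem_range.1 hj)
    have h1 : (1 : ℝ) ≤ 2 ^ j := one_le_pow₀ one_le_two
    have hsub : Ico (2 ^ j * s) (2 ^ (j + 1) * s) ⊆ uIcc a b := by
      intro t ht
      rw [mem_uIcc]
      left
      constructor
      · nlinarith [ht.1]
      · nlinarith [ht.2]
    rw [lintegral_indicator measurableSet_Ico, lintegral_const,
      Measure.restrict_restrict measurableSet_Ico, inter_eq_left.2 hsub,
      Measure.restrict_apply_univ, Real.volume_Ico, ← ENNReal.ofReal_mul (by positivity)]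
    refine ENNReal.ofReal_le_ofReal (le_of_eq ?_)
    have : (n : ℝ) ≠ 0 := by exact_mod_cast hn
    field_simp
    ring
  refine le_trans ?_ (Finset.sum_le_sum h)
  rw [Finset.sum_const, Finset.card_range, nsmul_eq_mul, ← ENNReal.ofReal_natCast,
    ← ENNReal.ofReal_mul (by positivity), mul_inv_cancel₀ (by exact_mod_cast hn)]
  simp

/-- The dyadic intervals are disjoint, so at most one summand is nonzero and the power passes inside
the sum. -/
theorem dyadicWeight_rpow_le {s : ℝ} (hs : 0 < s) (n : ℕ) {p : ℝ} (hp : 0 < p) (t : ℝ) :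
    dyadicWeight s n t ^ p ≤ ∑ j ∈ Finset.range n,
      (Ico (2 ^ j * s) (2 ^ (j + 1) * s)).indicator
        (fun _ => ENNReal.ofReal ((n * (2 ^ j * s))⁻¹) ^ p) t := by
  by_cases h : ∃ j ∈ Finset.range n, t ∈ Ico (2 ^ j * s) (2 ^ (j + 1) * s)
  · obtain ⟨j, hj, ht⟩ := h
    have : dyadicWeight s n t = ENNReal.ofReal ((n * (2 ^ j * s))⁻¹) := by
      unfold dyadicWeight
      rw [Finset.sum_eq_single_of_mem j hj, indicator_of_mem ht]
      intro i _ hij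
      refine indicator_of_notMem (fun hi => ?_) _
      rcases lt_or_gt_of_ne hij with h | h
      · have : (2 : ℝ) ^ (i + 1) ≤ 2 ^ j := pow_le_pow_right₀ one_le_two h
        nlinarith [hi.2, ht.1]
      · have : (2 : ℝ) ^ (j + 1) ≤ 2 ^ i := pow_le_pow_right₀ one_le_two h
        nlinarith [hi.1, ht.2]
    rw [this]
    refine le_trans ?_ (Finset.single_le_sum (fun _ _ => zero_le) hj)
    rw [indicator_of_mem ht]
  · push Not at h
    have : dyadicWeight s n t = 0 :=
      Finset.sum_eq_zero fun j hj => indicator_of_notMem (h j hj) _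
    rw [this, ENNReal.zero_rpow_of_pos hp]
    exact zero_le

variable [MeasurableSpace X]

/-- An upper bound for the modulus of the curves crossing an annulus. -/
theorem modulus_le_sum [BorelSpace X] (μ : Measure X) {p : ℝ} (hp : 0 < p) (x : X) {s : ℝ} (hs : 0 < s)
    {n : ℕ} (hn : n ≠ 0) {Γ : Set (RectCurve X)}
    (hΓ : ∀ γ ∈ Γ, dist (γ.toFun 0) x ≤ s ∧ 2 ^ n * s ≤ dist (γ.toFun γ.length) x) :
    modulus μ p Γ ≤ ∑ j ∈ Finset.range n,
      ENNReal.ofReal ((n * (2 ^ j * s))⁻¹) ^ p * μ (Metric.ball x (2 ^ (j + 1) * s)) := by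
  have hd : Measurable fun y : X => dist y x := (continuous_id.dist continuous_const).measurable
  refine (iInf₂_le (fun y => dyadicWeight s n (dist y x))
    ((measurable_dyadicWeight s n).comp hd)).trans ((iInf_le _ ?_).trans ?_)
  · intro γ hγ
    have hL : LipschitzOnWith 1 (fun t => dist (γ.toFun t) x) (Icc 0 γ.length) := by
      have := (LipschitzWith.dist_left x).comp_lipschitzOnWith γ.lipschitzOnWith
      simpa [Function.comp_def] using this
    exact (one_le_lintegral_dyadicWeight hs hn (hΓ γ hγ).1 (hΓ γ hγ).2).trans
      (lintegral_uIcc_le γ.length_pos.le hL (measurable_dyadicWeight s n))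
  · refine (lintegral_mono fun y => dyadicWeight_rpow_le hs n hp (dist y x)).trans ?_
    rw [lintegral_finsetSum]
    swap
    · intro j _
      exact Measurable.comp (g := (Ico (2 ^ j * s) (2 ^ (j + 1) * s)).indicator
        fun _ => ENNReal.ofReal ((n * (2 ^ j * s))⁻¹) ^ p)
        (measurable_const.indicator measurableSet_Ico) hd
    refine Finset.sum_le_sum fun j _ => ?_
    have : ∀ y : X, (Ico (2 ^ j * s) (2 ^ (j + 1) * s)).indicator
        (fun _ => ENNReal.ofReal ((n * (2 ^ j * s))⁻¹) ^ p) (dist y x) ≤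
        (Metric.ball x (2 ^ (j + 1) * s)).indicator
          (fun _ => ENNReal.ofReal ((n * (2 ^ j * s))⁻¹) ^ p) y := by
      intro y
      by_cases hy : dist y x ∈ Ico (2 ^ j * s) (2 ^ (j + 1) * s)
      · rw [indicator_of_mem hy, indicator_of_mem (Metric.mem_ball.2 hy.2)]
      · rw [indicator_of_notMem hy]
        exact zero_le
    refine (lintegral_mono this).trans ?_
    rw [lintegral_indicator_const Metric.isOpen_ball.measurableSet]

theorem measure_ball_le_of_mem_dimSet {μ : Measure X} {x : X} {q : ℝ} (hq : q ∈ dimSet μ x)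
    (hμ : ∀ r : ℝ, 0 < r → 0 < μ (Metric.ball x r) ∧ μ (Metric.ball x r) < ⊤) :
    ∃ C > 0, ∃ R > 0, ∀ r : ℝ, 0 < r → r ≤ R →
      μ (Metric.ball x r) ≤ ENNReal.ofReal (C * r ^ q) := by
  obtain ⟨hq0, C, hC, R, hR, h⟩ := hq
  have hpos : 0 < μ.real (Metric.ball x R) :=
    ENNReal.toReal_pos (hμ R hR).1.ne' (hμ R hR).2.ne
  refine ⟨C * μ.real (Metric.ball x R) / R ^ q, by positivity, R, hR, fun r hr hrR => ?_⟩
  rw [← ENNReal.ofReal_toReal (hμ r hr).2.ne]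
  refine ENNReal.ofReal_le_ofReal ?_
  have := h r R hr hrR le_rfl
  rw [div_le_iff₀ hpos, Real.div_rpow hr.le hR.le] at this
  refine this.trans (le_of_eq ?_)
  ring

/-- Since `r / R ≤ 1`, the set `Q(x)` is closed under decreasing the exponent. With `1 ∈ Q(x)` it
contains `(0, 1]`, so it can differ from it only by an exponent above `1`. -/
theorem exists_gt_one_mem_dimSet {μ : Measure X} {x : X} (h1 : (1 : ℝ) ∈ dimSet μ x)
    (hne : dimSet μ x ≠ Ioc 0 1) : ∃ q ∈ dimSet μ x, 1 < q := by
  by_contra! hcon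
  refine hne (Subset.antisymm (fun q hq => ⟨hq.1, hcon q hq⟩) fun q hq => ⟨hq.1, ?_⟩)
  obtain ⟨-, C, hC, R, hR, h⟩ := h1
  refine ⟨C, hC, R, hR, fun r R' hr hrR hR' => (h r R' hr hrR hR').trans ?_⟩
  have hR'0 : 0 < R' := hr.trans_le hrR
  gcongr ?_ * ?_
  exact Real.rpow_le_rpow_of_exponent_ge (by positivity) ((div_le_one hR'0).2 hrR) hq.2

/-- The quantity is `C * 2 ^ q * s ^ (q - p)`, which bounds the cost of the single annulus between
radii `s` and `2 * s`. -/
theorem exists_inv_rpow_mul_rpow_lt {C p q R : ℝ} (hpq : p < q) (hR : 0 < R)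
    {ε : ℝ} (hε : 0 < ε) : ∃ s : ℝ, 0 < s ∧ 2 * s < R ∧ s⁻¹ ^ p * (C * (2 * s) ^ q) < ε := by
  have h0 : Tendsto (fun s : ℝ => C * 2 ^ q * s ^ (q - p)) (𝓝[>] 0) (𝓝 0) := by
    have : Tendsto (fun s : ℝ => C * 2 ^ q * s ^ (q - p)) (𝓝 0) (𝓝 (C * 2 ^ q * 0 ^ (q - p))) :=
      ((Real.continuousAt_rpow_const 0 (q - p) (Or.inr (by linarith))).tendsto).const_mul _
    rw [Real.zero_rpow (by linarith), mul_zero] at this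
    exact this.mono_left nhdsWithin_le_nhds
  have h1 : ∀ᶠ s : ℝ in 𝓝[>] 0, C * 2 ^ q * s ^ (q - p) < ε := h0.eventually_lt_const hε
  have h2 : ∀ᶠ s : ℝ in 𝓝[>] 0, s ∈ Ioo 0 (R / 2) := Ioo_mem_nhdsGT (by positivity)
  obtain ⟨s, hs1, hs2⟩ := (h1.and h2).exists
  refine ⟨s, hs2.1, by linarith [hs2.2], lt_of_eq_of_lt ?_ hs1⟩
  rw [Real.mul_rpow (by norm_num) hs2.1.le, Real.inv_rpow hs2.1.le, Real.rpow_sub hs2.1]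
  field_simp

/-- The curves from a small ball around `x` to the complement of a fixed ball have small modulus,
if `p ∈ Q(x)` and `Q(x) ≠ (0, 1]`. -/
theorem exists_modulus_le [BorelSpace X] {μ : Measure X} {x : X}
    (hμ : ∀ r : ℝ, 0 < r → 0 < μ (Metric.ball x r) ∧ μ (Metric.ball x r) < ⊤)
    {p : ℝ} (hp : 1 ≤ p) (hpQ : p ∈ dimSet μ x) (hne : dimSet μ x ≠ Ioc 0 1)
    {R : ℝ} (hR : 0 < R) {ε : ℝ} (hε : 0 < ε) :
    ∃ s : ℝ, 0 < s ∧ ∀ Γ : Set (RectCurve X),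
      (∀ γ ∈ Γ, dist (γ.toFun 0) x ≤ s ∧ R ≤ dist (γ.toFun γ.length) x) →
        modulus μ p Γ ≤ ENNReal.ofReal ε := by
  have hp0 : 0 < p := by linarith
  -- For `p = 1` the bound `n ^ (1 - p)` from `n` annuli does not decay; there a single annulus and
  -- an exponent `q > 1` are used.
  rcases hp.eq_or_lt with rfl | hp1
  · obtain ⟨q, hq, hq1⟩ := exists_gt_one_mem_dimSet hpQ hne
    obtain ⟨C, hC, R₀, hR₀, hball⟩ := measure_ball_le_of_mem_dimSet hq hμ
    obtain ⟨s, hs, hsR, hsε⟩ := exists_inv_rpow_mul_rpow_lt (C := C) hq1 (lt_min hR hR₀) hε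
    refine ⟨s, hs, fun Γ hΓ => ?_⟩
    refine (modulus_le_sum μ hp0 x hs one_ne_zero fun γ hγ =>
      ⟨(hΓ γ hγ).1, ?_⟩).trans ?_
    · have := (hΓ γ hγ).2
      have := min_le_left R R₀
      linarith
    · rw [Finset.sum_range_one]
      have := hball (2 * s) (by positivity) (by linarith [min_le_right R R₀])
      simp only [Nat.cast_one, pow_zero, one_mul, zero_add, pow_one, ENNReal.rpow_one]
      refine (mul_le_mul_right this _).trans ?_
      rw [← ENNReal.ofReal_mul (by positivity)]
      refine ENNReal.ofReal_le_ofReal ?_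
      simpa using hsε.le
  · obtain ⟨C, hC, R₀, hR₀, hball⟩ := measure_ball_le_of_mem_dimSet hpQ hμ
    -- Each of `n` dyadic annuli costs at most `C * 2 ^ p * n ^ (-p)`, so together they cost this
    -- much.
    have hlim : Tendsto (fun n : ℕ => C * 2 ^ p * (n : ℝ) ^ (-(p - 1))) atTop (𝓝 0) := by
      have := ((tendsto_rpow_neg_atTop (y := p - 1) (by linarith)).comp
        tendsto_natCast_atTop_atTop).const_mul (C * 2 ^ p)
      simpa using this
    obtain ⟨n, hnε, hn1⟩ :=
      ((hlim.eventually_lt_const hε).and (eventually_ge_atTop 1)).exists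
    set R₁ := min R R₀
    have hR₁ : 0 < R₁ := lt_min hR hR₀
    have hn0 : (0 : ℝ) < n := by exact_mod_cast hn1
    have h2n : (0 : ℝ) < 2 ^ n := by positivity
    refine ⟨R₁ / 2 ^ n, by positivity, fun Γ hΓ => ?_⟩
    refine (modulus_le_sum μ hp0 x (by positivity) (by omega : n ≠ 0) fun γ hγ =>
      ⟨(hΓ γ hγ).1, ?_⟩).trans ?_
    · rw [mul_div_cancel₀ _ h2n.ne']
      exact (min_le_left _ _).trans (hΓ γ hγ).2
    · have hterm : ∀ j ∈ Finset.range n,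
          ENNReal.ofReal ((n * (2 ^ j * (R₁ / 2 ^ n)))⁻¹) ^ p *
            μ (Metric.ball x (2 ^ (j + 1) * (R₁ / 2 ^ n))) ≤
          ENNReal.ofReal (C * 2 ^ p * (n : ℝ) ^ (-p)) := by
        intro j hj
        set a := 2 ^ j * (R₁ / 2 ^ n) with ha
        have ha0 : 0 < a := by positivity
        have h2a : 2 ^ (j + 1) * (R₁ / 2 ^ n) = 2 * a := by rw [ha]; ring
        have hle : 2 * a ≤ R₀ := by
          rw [← h2a]
          have : (2 : ℝ) ^ (j + 1) ≤ 2 ^ n :=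
            pow_le_pow_right₀ one_le_two (Finset.mem_range.1 hj)
          calc 2 ^ (j + 1) * (R₁ / 2 ^ n) ≤ 2 ^ n * (R₁ / 2 ^ n) := by gcongr
            _ = R₁ := mul_div_cancel₀ _ h2n.ne'
            _ ≤ R₀ := min_le_right _ _
        rw [h2a, ENNReal.ofReal_rpow_of_nonneg (by positivity) hp0.le]
        refine (mul_le_mul_right (hball (2 * a) (by positivity) hle) _).trans ?_
        rw [← ENNReal.ofReal_mul (by positivity)]
        refine ENNReal.ofReal_le_ofReal (le_of_eq ?_)
        rw [Real.inv_rpow (by positivity), Real.mul_rpow hn0.le ha0.le,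
          Real.mul_rpow (by norm_num) ha0.le, Real.rpow_neg hn0.le]
        have : a ^ p ≠ 0 := by positivity
        field_simp
      refine (Finset.sum_le_sum hterm).trans ?_
      rw [Finset.sum_const, Finset.card_range, nsmul_eq_mul, ← ENNReal.ofReal_natCast,
        ← ENNReal.ofReal_mul (by positivity)]
      refine ENNReal.ofReal_le_ofReal (le_trans (le_of_eq ?_) hnε.le)
      have : (n : ℝ) ^ (-(p - 1)) = n * (n : ℝ) ^ (-p) := by
        rw [show -(p - 1) = 1 + -p by ring, Real.rpow_add hn0, Real.rpow_one]
      rw [this]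
      ring

end Modulus

/-! ### Doubling and properness -/

section Doubling

variable {X : Type*} [MetricSpace X] [MeasurableSpace X]

theorem IsDoubling.measure_ball_two_pow_le {μ : Measure X} {C : ℝ≥0}
    (hC : ∀ (x : X) (r : ℝ), 0 < r → μ (Metric.ball x (2 * r)) ≤ C * μ (Metric.ball x r))
    (x : X) {r : ℝ} (hr : 0 < r) (n : ℕ) :
    μ (Metric.ball x (2 ^ n * r)) ≤ (C : ℝ≥0∞) ^ n * μ (Metric.ball x r) := by
  induction n with
  | zero => simp
  | succ n ih =>
    rw [pow_succ', mul_assoc, pow_succ', mul_assoc]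
    refine (hC x _ (by positivity)).trans ?_
    gcongr

/-- A complete metric space with a doubling measure is proper. -/
theorem IsDoubling.properSpace [CompleteSpace X] [BorelSpace X] {μ : Measure X}
    (hd : IsDoubling μ)
    (hμ : ∀ (x : X) (r : ℝ), 0 < r → 0 < μ (Metric.ball x r) ∧ μ (Metric.ball x r) < ⊤) :
    ProperSpace X := by
  obtain ⟨C, hC0, hC⟩ := hd
  refine ⟨fun x R => ?_⟩
  refine isCompact_iff_totallyBounded_isComplete.2 ⟨?_, Metric.isClosed_closedBall.isComplete⟩
  rw [Metric.totallyBounded_iff]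
  by_contra! hcon
  obtain ⟨ε, hε, hcov⟩ := hcon
  -- Without a finite `ε`-net there is an infinite `ε`-separated sequence. Its balls of radius `ε /
  -- 2` are disjoint, lie in one ball of finite measure, and by doubling have measure bounded below.
  obtain ⟨f, hf, hsep⟩ := exists_seq_of_forall_finset_exists (fun y => y ∈ Metric.closedBall x R)
    (fun y z => ε ≤ dist z y) fun s _ => by
      obtain ⟨z, hz, hz'⟩ := not_subset.1 (hcov s s.finite_toSet)
      refine ⟨z, hz, fun y hy => ?_⟩
      by_contra! hlt
      exact hz' (mem_iUnion₂.2 ⟨y, hy, hlt⟩)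
  have hR : 0 ≤ R := dist_nonneg.trans (hf 0)
  have hdisj : Pairwise (Function.onFun Disjoint fun n => Metric.ball (f n) (ε / 2)) := by
    intro m n hmn
    refine Metric.ball_disjoint_ball ?_
    rcases lt_or_gt_of_ne hmn with h | h
    · have := hsep m n h
      rw [dist_comm] at this
      linarith
    · linarith [hsep n m h]
  obtain ⟨k, hk⟩ := pow_unbounded_of_one_lt ((2 * R + 1) / (ε / 2)) one_lt_two
  rw [div_lt_iff₀ (by positivity)] at hk
  set c := μ (Metric.ball x 1) / (C : ℝ≥0∞) ^ k
  have hc0 : c ≠ 0 := ENNReal.div_ne_zero.2 ⟨(hμ x 1 one_pos).1.ne', by simp⟩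
  have hlow : ∀ n, c ≤ μ (Metric.ball (f n) (ε / 2)) := by
    intro n
    refine ENNReal.div_le_of_le_mul' (le_trans (measure_mono ?_)
      (measure_ball_two_pow_le hC (f n) (by positivity) k))
    refine Metric.ball_subset_ball' ?_
    have := hf n
    rw [Metric.mem_closedBall, dist_comm] at this
    linarith
  have h1 : ∑' _ : ℕ, c ≤ μ (Metric.ball x (R + ε)) :=
    (ENNReal.tsum_le_tsum hlow).trans <| by
      rw [← measure_iUnion hdisj fun n => Metric.isOpen_ball.measurableSet]
      refine measure_mono (iUnion_subset fun n => Metric.ball_subset_ball' ?_)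
      have := Metric.mem_closedBall.1 (hf n)
      linarith
  rw [ENNReal.tsum_const_eq_top_of_ne_zero hc0, top_le_iff] at h1
  exact (hμ x (R + ε) (by positivity)).2.ne h1

end Doubling

/-! ### From mean oscillation to Lipschitz bounds -/

section Telescoping

/-- If the mean oscillation over a ball `A` is at most `a`, then the averages over `A` and over a
subset `B` of comparable measure are close. -/
theorem abs_sub_average_le {X : Type*} [MeasurableSpace X] {μ : Measure X} {v : X → ℝ} {A B : Set X} (hBA : B ⊆ A)
    (hB : μ B ≠ 0) (hA : μ A ≠ ⊤) {D : ℝ≥0} (hAB : μ A ≤ D * μ B)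
    (hv : IntegrableOn v A μ) {c a : ℝ} (ha : 0 ≤ a)
    (hosc : ⨍⁻ y in A, ‖v y - c‖ₑ ∂μ ≤ ENNReal.ofReal a) :
    |(⨍ y in B, v y ∂μ) - c| ≤ D * a := by
  have hB' : μ B ≠ ⊤ := measure_ne_top_of_subset hBA hA
  have hA0 : μ A ≠ 0 := fun h => hB (measure_mono_null hBA h)
  have : IsFiniteMeasure (μ.restrict B) := ⟨by simpa using hB'.lt_top⟩
  have : NeZero (μ.restrict B) := ⟨by simpa using hB⟩
  have hvB : IntegrableOn v B μ := hv.mono_set hBA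
  have h1 : (⨍ y in B, v y ∂μ) - c = ⨍ y in B, (v y - c) ∂μ := by
    rw [average_eq, average_eq, integral_sub hvB (integrable_const c), smul_sub, integral_const,
      smul_smul, inv_mul_cancel₀, one_smul]
    rw [measureReal_restrict_apply_univ]
    exact (ENNReal.toReal_pos hB hB').ne'
  have h2 : ‖(⨍ y in B, v y ∂μ) - c‖ₑ ≤ ⨍⁻ y in B, ‖v y - c‖ₑ ∂μ := by
    rw [h1]
    exact enorm_integral_le_lintegral_enorm _
  have h3 : ⨍⁻ y in B, ‖v y - c‖ₑ ∂μ ≤ D * ⨍⁻ y in A, ‖v y - c‖ₑ ∂μ := by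
    rw [setLAverage_eq, setLAverage_eq, ← mul_div_assoc]
    refine ENNReal.div_le_of_le_mul ?_
    rw [← ENNReal.mul_div_right_comm, ENNReal.le_div_iff_mul_le (Or.inl hA0) (Or.inl hA)]
    calc (∫⁻ y in B, ‖v y - c‖ₑ ∂μ) * μ A
        ≤ (∫⁻ y in A, ‖v y - c‖ₑ ∂μ) * (D * μ B) :=
          mul_le_mul' (lintegral_mono_set hBA) hAB
      _ = _ := by ring
  have h4 := h2.trans (h3.trans (mul_le_mul_right hosc _))
  rw [← ofReal_norm, Real.norm_eq_abs, ← ENNReal.ofReal_coe_nnreal,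
    ← ENNReal.ofReal_mul (by positivity), ENNReal.ofReal_le_ofReal_iff (by positivity)] at h4
  exact h4

/-- A function whose mean oscillation over balls is bounded by a multiple of the
radius, and which is Lipschitz at small scales, is Lipschitz with a constant independent of the
scale. -/
theorem abs_sub_le_of_oscillation {X : Type*} [MetricSpace X] [MeasurableSpace X] {μ : Measure X} {C : ℝ≥0}
    (hC : ∀ (x : X) (r : ℝ), 0 < r → μ (Metric.ball x (2 * r)) ≤ C * μ (Metric.ball x r))
    (hμ : ∀ (x : X) (r : ℝ), 0 < r → 0 < μ (Metric.ball x r) ∧ μ (Metric.ball x r) < ⊤)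
    {v : X → ℝ} (hv : ∀ x r, IntegrableOn v (Metric.ball x r) μ) {a ε : ℝ} (ha : 0 ≤ a)
    (hε : 0 < ε) (hloc : ∀ y z, dist y z ≤ ε → |v y - v z| ≤ dist y z)
    (hosc : ∀ x r, 0 < r → ⨍⁻ y in Metric.ball x r,
      ‖v y - ⨍ z in Metric.ball x r, v z ∂μ‖ₑ ∂μ ≤ ENNReal.ofReal (a * r)) (y z : X) :
    |v y - v z| ≤ (3 + 6 * C * a + 2 * C ^ 2 * a) * dist y z := by
  -- Passing from radius `r / 2` to `r` costs `C * a * r`, and `(1 + 2 * C * a) * (r / 2) + C * a *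
  -- r ≤ (1 + 2 * C * a) * r`. The bound thus survives every doubling, and `ε` leaves no trace.
  have hK : ∀ n : ℕ, ∀ r, 0 < r → r ≤ 2 ^ n * ε → ∀ w : X,
      |v w - ⨍ z in Metric.ball w r, v z ∂μ| ≤ (1 + 2 * C * a) * r := by
    intro n
    induction n with
    | zero =>
      intro r hr hrε w
      have hpos : 0 < μ.real (Metric.ball w r) :=
        ENNReal.toReal_pos (hμ w r hr).1.ne' (hμ w r hr).2.ne
      have hle : ∀ b ∈ Metric.ball w r, ‖v b - v w‖ ≤ r := fun b hb => by
        rw [Real.norm_eq_abs]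
        have hb' := (Metric.mem_ball.1 hb).le
        exact (hloc b w (by linarith)).trans hb'
      have h1 := norm_setIntegral_le_of_norm_le_const (μ := μ) (hμ w r hr).2 hle
      have : IsFiniteMeasure (μ.restrict (Metric.ball w r)) := ⟨by simpa using (hμ w r hr).2⟩
      rw [integral_sub (hv w r) (integrable_const _), integral_const,
        measureReal_restrict_apply_univ] at h1
      have h2 : |v w - ⨍ z in Metric.ball w r, v z ∂μ| ≤ r := by
        rw [setAverage_eq, smul_eq_mul, abs_sub_comm]
        rw [Real.norm_eq_abs, smul_eq_mul] at h1
        rw [show (μ.real (Metric.ball w r))⁻¹ * (∫ z in Metric.ball w r, v z ∂μ) - v w =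
          (μ.real (Metric.ball w r))⁻¹ * ((∫ z in Metric.ball w r, v z ∂μ) -
            μ.real (Metric.ball w r) * v w) by field_simp, abs_mul, abs_inv,
            abs_of_pos hpos, inv_mul_le_iff₀ hpos]
        linarith
      have : 0 ≤ C * a * r := by positivity
      nlinarith
    | succ n ih =>
      intro r hr hrn w
      have h1 := ih (r / 2) (by positivity) (by rw [pow_succ] at hrn; linarith) w
      have h2 := abs_sub_average_le (μ := μ) (v := v) (A := Metric.ball w r)
        (B := Metric.ball w (r / 2)) (Metric.ball_subset_ball (by linarith))
        (hμ w _ (by positivity)).1.ne' (hμ w r hr).2.ne (D := C)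
        (by simpa [mul_div_cancel₀] using hC w (r / 2) (by positivity)) (hv w r)
        (by positivity) (hosc w r hr)
      have h3 := abs_sub_le (v w) (⨍ z in Metric.ball w (r / 2), v z ∂μ)
        (⨍ z in Metric.ball w r, v z ∂μ)
      nlinarith
  have hK' : ∀ r, 0 < r → ∀ w : X,
      |v w - ⨍ z in Metric.ball w r, v z ∂μ| ≤ (1 + 2 * C * a) * r := by
    intro r hr w
    obtain ⟨n, hn⟩ := pow_unbounded_of_one_lt (r / ε) one_lt_two
    rw [div_lt_iff₀ hε] at hn
    exact hK n r hr hn.le w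
  rcases eq_or_ne y z with rfl | hyz
  · simp
  set r := dist y z with hr
  have hr0 : 0 < r := dist_pos.2 hyz
  have h1 := hK' r hr0 y
  have h2 := hK' (2 * r) (by positivity) z
  -- `B(y, r) ⊆ B(z, 2r) ⊆ B(y, 4r)`, so two doublings compare the measures.
  have h3 := abs_sub_average_le (μ := μ) (v := v) (A := Metric.ball z (2 * r))
    (B := Metric.ball y r) (Metric.ball_subset_ball' (by rw [← hr]; linarith))
    (hμ y _ hr0).1.ne' (hμ z _ (by positivity)).2.ne (D := C ^ 2) (by
      refine (measure_mono (Metric.ball_subset_ball' (ε₂ := 2 ^ 2 * r) (y := y) ?_)).trans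
        ((IsDoubling.measure_ball_two_pow_le hC y hr0 2).trans (by simp))
      rw [dist_comm, ← hr]; linarith) (hv z _) (by positivity) (hosc z _ (by positivity))
  push_cast at h3
  have h4 := abs_sub_le (v y) (⨍ b in Metric.ball y r, v b ∂μ) (v z)
  have h5 := abs_sub_le (⨍ b in Metric.ball y r, v b ∂μ) (⨍ b in Metric.ball z (2 * r), v b ∂μ)
    (v z)
  rw [abs_sub_comm (⨍ b in Metric.ball z (2 * r), v b ∂μ)] at h5
  nlinarith

end Telescoping

/-! ### Test functions for the Poincaré inequality -/

section TestFunctions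

theorem lipschitzOnWith_Icc_of_local {h : ℝ → ℝ} {l ε : ℝ} (hε : 0 < ε)
    (hloc : ∀ s ∈ Icc 0 l, ∀ t ∈ Icc 0 l, |s - t| ≤ ε → |h s - h t| ≤ |s - t|) :
    LipschitzOnWith 1 h (Icc 0 l) := by
  have key : ∀ n : ℕ, ∀ s ∈ Icc 0 l, ∀ t ∈ Icc 0 l, s ≤ t → t - s ≤ n * ε →
      |h s - h t| ≤ t - s := by
    intro n
    induction n with
    | zero =>
      intro s hs t ht hst hn
      have : s = t := by simp at hn; linarith
      subst this
      simp
    | succ n ih =>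
      intro s hs t ht hst hn
      rcases le_total (t - s) ε with h1 | h1
      · have h2 : |s - t| = t - s := by rw [abs_sub_comm, abs_of_nonneg (by linarith)]
        exact h2 ▸ hloc s hs t ht (by rw [h2]; exact h1)
      · have hm : t - ε ∈ Icc 0 l := ⟨by linarith [hs.1], by linarith [ht.2]⟩
        push_cast at hn
        have h2 := ih s hs (t - ε) hm (by linarith) (by linarith)
        have h3 : |t - ε - t| = ε := by rw [show t - ε - t = -ε by ring, abs_neg, abs_of_pos hε]
        have h4 := hloc _ hm t ht h3.le
        have := abs_sub_le (h s) (h (t - ε)) (h t)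
        linarith
  refine LipschitzOnWith.of_dist_le_mul fun s hs t ht => ?_
  rw [NNReal.coe_one, one_mul, Real.dist_eq, Real.dist_eq]
  obtain ⟨n, hn⟩ := exists_nat_ge (|s - t| / ε)
  rw [div_le_iff₀ hε] at hn
  rcases le_total s t with hst | hst
  · rw [abs_sub_comm s t, abs_of_nonneg (sub_nonneg.2 hst)] at hn ⊢
    exact key n s hs t ht hst hn
  · rw [abs_of_nonneg (sub_nonneg.2 hst)] at hn ⊢
    rw [abs_sub_comm]
    exact key n t ht s hs hst hn

variable {X : Type*} [MetricSpace X]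

/-- A nonnegative bounded function, supported in the ball `B(x₀, N)`, which is `1`-Lipschitz at
scale `ε`. -/
structure IsTestFunction (x₀ : X) (N ε : ℝ) (v : X → ℝ) : Prop where
  nonneg : ∀ y, 0 ≤ v y
  le : ∀ y, v y ≤ N
  eq_zero : ∀ y, N ≤ dist y x₀ → v y = 0
  local_lipschitz : ∀ y z, dist y z ≤ ε → |v y - v z| ≤ dist y z

namespace IsTestFunction

variable {x₀ : X} {N ε : ℝ} {v : X → ℝ}

theorem continuous (hv : IsTestFunction x₀ N ε v) (hε : 0 < ε) : Continuous v := by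
  refine Metric.continuous_iff.2 fun z η hη => ⟨min ε η, lt_min hε hη, fun y hy => ?_⟩
  rw [Real.dist_eq]
  exact (hv.local_lipschitz y z (hy.le.trans (min_le_left _ _))).trans_lt
    (hy.trans_le (min_le_right _ _))

variable [MeasurableSpace X] [BorelSpace X]

/-- Every positive value between the values of `v` at the endpoints of `γ` is attained at a point of
the ball. As `v ∘ γ` is `1`-Lipschitz, `γ` spends at least that much length there. Restricting the
gradient to the ball keeps it in `L^p` even if `μ` is infinite. -/
theorem isUpperGradient (hv : IsTestFunction x₀ N ε v) (hε : 0 < ε) :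
    IsUpperGradient ((Metric.ball x₀ N).indicator 1) (fun y => (v y : EReal)) := by
  refine ⟨measurable_one.indicator Metric.isOpen_ball.measurableSet, fun γ => ⟨fun _ => ?_, ?_⟩⟩
  · have hL : LipschitzOnWith 1 (fun t => v (γ.toFun t)) (Icc 0 γ.length) := by
      refine lipschitzOnWith_Icc_of_local hε fun s hs t ht hst => ?_
      have := γ.lipschitzOnWith.dist_le_mul s hs t ht
      rw [NNReal.coe_one, one_mul, Real.dist_eq] at this
      exact (hv.local_lipschitz _ _ (this.trans hst)).trans this
    have h1 := lintegral_uIcc_le γ.length_pos.le hL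
      (F := (Ioi 0).indicator 1) (measurable_one.indicator measurableSet_Ioi)
    rw [lintegral_indicator_one measurableSet_Ioi,
      Measure.restrict_apply measurableSet_Ioi] at h1
    rw [← EReal.coe_sub, EReal.abs_def]
    calc ENNReal.ofReal |v (γ.toFun 0) - v (γ.toFun γ.length)|
        = volume (uIoc (v (γ.toFun 0)) (v (γ.toFun γ.length))) := by
          rw [uIoc, Real.volume_Ioc, abs_sub_comm, max_sub_min_eq_abs]
      _ ≤ volume (Ioi 0 ∩ uIcc (v (γ.toFun 0)) (v (γ.toFun γ.length))) := by
          refine measure_mono fun c hc => ⟨?_, uIoc_subset_uIcc hc⟩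
          exact (le_min (hv.nonneg _) (hv.nonneg _)).trans_lt hc.1
      _ ≤ _ := h1
      _ ≤ γ.lineIntegral ((Metric.ball x₀ N).indicator 1) := by
          refine lintegral_mono fun t => ?_
          by_cases ht : v (γ.toFun t) ∈ Ioi 0
          · have : γ.toFun t ∈ Metric.ball x₀ N := by
              by_contra hcon
              exact (mem_Ioi.1 ht).ne' (hv.eq_zero _ (not_lt.1 hcon))
            rw [indicator_of_mem ht, indicator_of_mem this]
            rfl
          · rw [indicator_of_notMem ht]
            exact zero_le
  · intro h
    exact absurd ⟨(EReal.abs_coe_lt_top _).ne, (EReal.abs_coe_lt_top _).ne⟩ h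

theorem lintegral_indicator_rpow_lt_top {μ : Measure X} {p : ℝ} (hp : 0 < p)
    (hN : μ (Metric.ball x₀ N) < ⊤) :
    ∫⁻ y, (Metric.ball x₀ N).indicator (1 : X → ℝ≥0∞) y ^ p ∂μ < ⊤ := by
  have : ∀ y, (Metric.ball x₀ N).indicator (1 : X → ℝ≥0∞) y ^ p =
      (Metric.ball x₀ N).indicator 1 y := by
    intro y
    by_cases hy : y ∈ Metric.ball x₀ N
    · simp [hy]
    · simp [hy, hp]
  simp_rw [this]
  rw [lintegral_indicator_one Metric.isOpen_ball.measurableSet]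
  exact hN

theorem memNewtonian (hv : IsTestFunction x₀ N ε v) (hε : 0 < ε) {μ : Measure X} {p : ℝ}
    (hp : 0 < p) (hN : μ (Metric.ball x₀ N) < ⊤) :
    MemNewtonian μ p (fun y => (v y : EReal)) := by
  refine ⟨(measurable_coe_real_ereal.comp (hv.continuous hε).measurable).aemeasurable, ?_⟩
  refine ENNReal.rpow_lt_top_of_nonneg (by positivity) (ENNReal.add_ne_top.2 ⟨?_, ?_⟩)
  · have : ∀ y, (v y : EReal).abs ^ p ≤
        ENNReal.ofReal N ^ p * (Metric.ball x₀ N).indicator 1 y := by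
      intro y
      rw [EReal.abs_def, abs_of_nonneg (hv.nonneg y)]
      by_cases hy : y ∈ Metric.ball x₀ N
      · rw [indicator_of_mem hy, Pi.one_apply, mul_one]
        exact ENNReal.rpow_le_rpow (ENNReal.ofReal_le_ofReal (hv.le y)) hp.le
      · rw [hv.eq_zero y (not_lt.1 hy)]
        simp [hp]
    refine ((lintegral_mono this).trans_lt ?_).ne
    rw [lintegral_const_mul _ (measurable_one.indicator Metric.isOpen_ball.measurableSet),
      lintegral_indicator_one Metric.isOpen_ball.measurableSet]
    exact ENNReal.mul_lt_top (ENNReal.rpow_lt_top_of_nonneg hp.le ENNReal.ofReal_ne_top) hN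
  · refine (lt_of_le_of_lt ?_ (lintegral_indicator_rpow_lt_top (x₀ := x₀) hp hN)).ne
    exact (iInf_le _ _).trans (iInf_le _ (hv.isUpperGradient hε))

end IsTestFunction

variable [MeasurableSpace X] [BorelSpace X]

/-- Under the Poincaré inequality, functions which are `1`-Lipschitz at an arbitrarily small scale
are Lipschitz with a constant independent of the scale. -/
theorem SupportsPoincare.exists_lipschitz_const {μ : Measure X} {p : ℝ} (hp : 0 < p)
    (hP : SupportsPoincare μ p) (hd : IsDoubling μ)
    (hμ : ∀ (x : X) (r : ℝ), 0 < r → 0 < μ (Metric.ball x r) ∧ μ (Metric.ball x r) < ⊤) :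
    ∃ K : ℝ, 0 ≤ K ∧ ∀ (x₀ : X) (N ε : ℝ) (v : X → ℝ), 0 < N → 0 < ε →
      IsTestFunction x₀ N ε v → ∀ y z, |v y - v z| ≤ K * dist y z := by
  obtain ⟨D, hD0, hD⟩ := hd
  obtain ⟨C, hC0, lam, hlam, hPI⟩ := hP
  refine ⟨3 + 6 * D * (2 * C) + 2 * D ^ 2 * (2 * C), by positivity,
    fun x₀ N ε v hN hε hv y z => ?_⟩
  refine abs_sub_le_of_oscillation hD hμ (fun x r => ?_) (by positivity) hε hv.local_lipschitz
    (fun x r hr => ?_) y z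
  · rcases le_or_gt r 0 with hr | hr
    · rw [Metric.ball_eq_empty.2 hr]
      exact integrableOn_empty
    · exact Measure.integrableOn_of_bounded (M := N) (hμ x r hr).2.ne
        (hv.continuous hε).measurable.aestronglyMeasurable
        (Eventually.of_forall fun y => by
          rw [Real.norm_eq_abs, abs_of_nonneg (hv.nonneg y)]; exact hv.le y)
  · have h := hPI x r hr _ (hv.memNewtonian hε hp (hμ x₀ N hN).2) _ (hv.isUpperGradient hε)
      (IsTestFunction.lintegral_indicator_rpow_lt_top hp (hμ x₀ N hN).2)
    simp only [EReal.toReal_coe] at h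
    refine h.trans ?_
    -- The gradient is at most `1`, so its mean is too; with `diam B ≤ 2 * r` the oscillation is at
    -- most `2 * C * r`.
    have h1 : ⨍⁻ y in Metric.ball x (lam * r),
        (Metric.ball x₀ N).indicator (1 : X → ℝ≥0∞) y ^ p ∂μ ≤ 1 := by
      rw [setLAverage_eq]
      refine ENNReal.div_le_of_le_mul ?_
      rw [one_mul]
      refine (lintegral_mono (g := fun _ => 1) fun y => ?_).trans (by simp)
      by_cases hy : y ∈ Metric.ball x₀ N
      · simp [hy]
      · simp [hy, hp]
    have h2 : Metric.ediam (Metric.ball x r) ≤ ENNReal.ofReal (2 * r) := by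
      refine Metric.ediam_le fun y hy z hz => ?_
      rw [edist_dist]
      refine ENNReal.ofReal_le_ofReal ?_
      have := dist_triangle_right y z x
      linarith [Metric.mem_ball.1 hy, Metric.mem_ball.1 hz]
    calc _ ≤ (C : ℝ≥0∞) * ENNReal.ofReal (2 * r) * 1 := by
          gcongr
          exact ENNReal.rpow_le_one h1 (by positivity)
      _ = _ := by
          rw [mul_one, ← ENNReal.ofReal_coe_nnreal, ← ENNReal.ofReal_mul (by positivity)]
          congr 1
          ring

end TestFunctions

/-! ### Discrete curves and local path connectedness -/

section DiscreteCurves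

variable {X : Type*} [MetricSpace X]

/-- There is a discrete curve from `x` to `y`, with jumps at most `ε`, of length `l`. -/
def HasDiscreteCurve (ε : ℝ) (x y : X) (l : ℝ) : Prop :=
  0 ≤ l ∧ ∃ f : ℝ → X, f 0 = x ∧ f l = y ∧
    ∀ s t, 0 ≤ s → s ≤ t → t ≤ l → dist (f s) (f t) ≤ t - s + ε

theorem HasDiscreteCurve.refl {ε : ℝ} (hε : 0 ≤ ε) (x : X) : HasDiscreteCurve ε x x 0 :=
  ⟨le_rfl, fun _ => x, rfl, rfl, fun s t _ hst _ => by rw [dist_self]; linarith⟩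

theorem HasDiscreteCurve.extend {ε : ℝ} {x y z : X} {l : ℝ} (h : HasDiscreteCurve ε x y l)
    (hyz : dist y z ≤ ε) : HasDiscreteCurve ε x z (l + dist y z) := by
  rcases eq_or_ne y z with rfl | hne
  · simpa using h
  obtain ⟨hl, f, hf0, hfl, hf⟩ := h
  have hδ : 0 < dist y z := dist_pos.2 hne
  -- The curve waits at `y` during the extra time and jumps to `z` at its end; the jump is absorbed
  -- by the error `ε`.
  refine ⟨by positivity, fun t => if t < l + dist y z then f (min t l) else z, ?_, by simp, ?_⟩
  · simp only
    rw [if_pos (by positivity), min_eq_left hl, hf0]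
  · intro s t hs hst ht
    simp only
    split_ifs with h1 h2 h2
    · refine (hf _ _ (le_min hs hl) (min_le_min_right l hst) (min_le_right _ _)).trans ?_
      have : min t l - min s l ≤ t - s := by
        rcases le_total t l with h | h <;> rcases le_total s l with h' | h' <;>
          simp only [h, h', min_eq_left, min_eq_right] <;> linarith
      linarith
    · have htl : t = l + dist y z := le_antisymm ht (not_lt.1 h2)
      rcases le_total s l with h | h
      · rw [min_eq_left h, htl]
        have h3 := hf s l hs h le_rfl
        rw [hfl] at h3
        linarith [dist_triangle (f s) y z]
      · rw [min_eq_right h, hfl]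
        linarith
    · exact absurd (hst.trans_lt h2) h1
    · rw [dist_self]
      linarith

/-- The truncated length distance from `x` along discrete curves. -/
noncomputable def discreteDist (ε N : ℝ) (x y : X) : ℝ :=
  sInf (insert N {l | HasDiscreteCurve ε x y l})

section

variable {ε N : ℝ} {x y z : X}

theorem discreteDist_bddBelow (hN : 0 ≤ N) :
    BddBelow (insert N {l | HasDiscreteCurve ε x y l}) := by
  refine ⟨0, ?_⟩
  rintro l (rfl | hl)
  · exact hN
  · exact hl.1

theorem discreteDist_nonneg (hN : 0 ≤ N) : 0 ≤ discreteDist ε N x y := by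
  refine le_csInf (insert_nonempty _ _) ?_
  rintro l (rfl | hl)
  · exact hN
  · exact hl.1

theorem discreteDist_le (hN : 0 ≤ N) : discreteDist ε N x y ≤ N :=
  csInf_le (discreteDist_bddBelow hN) (mem_insert _ _)

theorem discreteDist_self (hε : 0 ≤ ε) (hN : 0 ≤ N) : discreteDist ε N x x = 0 :=
  le_antisymm (csInf_le (discreteDist_bddBelow hN) (Or.inr (.refl hε x)))
    (discreteDist_nonneg hN)

theorem discreteDist_le_add (hN : 0 ≤ N) (hyz : dist y z ≤ ε) :
    discreteDist ε N x z ≤ discreteDist ε N x y + dist y z := by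
  rw [← sub_le_iff_le_add]
  refine le_csInf (insert_nonempty _ _) ?_
  rintro l (rfl | hl)
  · linarith [discreteDist_le (ε := ε) (x := x) (y := z) hN, dist_nonneg (x := y) (y := z)]
  · rw [sub_le_iff_le_add]
    exact csInf_le (discreteDist_bddBelow hN) (Or.inr (hl.extend hyz))

theorem exists_hasDiscreteCurve {a : ℝ} (h : discreteDist ε N x y < a) (ha : a ≤ N) :
    ∃ l < a, HasDiscreteCurve ε x y l := by
  obtain ⟨l, hl | hl, hla⟩ := exists_lt_of_csInf_lt (insert_nonempty _ _) h
  · exact absurd hla (by rw [hl]; exact ha.not_gt)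
  · exact ⟨l, hla, hl⟩

/-- The cutoff `N - d(·, x)` supplies the support. Points not reached by any discrete curve do no
harm, since the discrete distance is truncated at `N`. -/
theorem isTestFunction_discreteDist (hN : 0 ≤ N) (x : X) :
    IsTestFunction x N ε fun y => min (discreteDist ε N x y) (max 0 (N - dist y x)) where
  nonneg y := le_min (discreteDist_nonneg hN) (le_max_left _ _)
  le y := (min_le_left _ _).trans (discreteDist_le hN)
  eq_zero y hy := by
    rw [max_eq_left (by linarith), min_eq_right (discreteDist_nonneg hN)]
  local_lipschitz y z hyz := by
    refine (abs_min_sub_min_le_max _ _ _ _).trans (max_le ?_ ?_)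
    · have h1 := discreteDist_le_add (x := x) hN hyz
      have h2 := discreteDist_le_add (x := x) hN ((dist_comm z y).trans_le hyz)
      rw [dist_comm z y] at h2
      rw [abs_le]
      constructor <;> linarith
    · refine (abs_max_sub_max_le_max _ _ _ _).trans (max_le (by simp) ?_)
      rw [show N - dist y x - (N - dist z x) = dist z x - dist y x by ring, dist_comm y z]
      exact abs_dist_sub_le z y x

end

/-- Limits of discrete curves are rectifiable curves. -/
theorem joinedIn_of_hasDiscreteCurve [ProperSpace X] {y z : X} {L : ℝ} (hL : 0 ≤ L)
    (h : ∀ ε > 0, ∃ l ≤ L, HasDiscreteCurve ε y z l) :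
    JoinedIn (Metric.closedBall y L) y z := by
  have h' : ∀ n : ℕ, ∃ f : ℝ → X, f 0 = y ∧ f L = z ∧
      ∀ s t, 0 ≤ s → s ≤ t → t ≤ L → dist (f s) (f t) ≤ t - s + 1 / ((n : ℝ) + 1) := by
    intro n
    obtain ⟨l, hlL, hl, f, hf0, hfl, hf⟩ := h (1 / ((n : ℝ) + 1)) (by positivity)
    refine ⟨fun t => f (min t l), by simp [hl, hf0], by simp [hlL, hfl], fun s t hs hst _ => ?_⟩
    refine (hf _ _ (le_min hs hl) (min_le_min_right l hst) (min_le_right _ _)).trans ?_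
    have : min t l - min s l ≤ t - s := by
      rcases le_total t l with h | h <;> rcases le_total s l with h' | h' <;>
        simp only [h, h', min_eq_left, min_eq_right] <;> linarith
    linarith
  choose f hf0 hfL hf using h'
  -- The discrete curves need not be continuous, but stay in a compact ball. Pointwise limits along
  -- an ultrafilter exist, and the vanishing errors make the limit `1`-Lipschitz.
  let U : Ultrafilter ℕ := hyperfilter ℕ
  have hU : (U : Filter ℕ) ≤ atTop := by
    rw [← Nat.cofinite_eq_atTop]
    exact hyperfilter_le_cofinite
  have hg : ∀ t : ℝ, ∃ a : X, t ∈ Icc 0 L → Tendsto (fun n => f n t) U (𝓝 a) := by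
    intro t
    by_cases ht : t ∈ Icc 0 L
    · obtain ⟨a, -, ha⟩ := (isCompact_closedBall y (L + 1)).ultrafilter_le_nhds
        (U.map fun n => f n t) (by
          rw [le_principal_iff]
          refine Filter.mem_map.2 (Filter.univ_mem' fun n => ?_)
          rw [mem_preimage, Metric.mem_closedBall, dist_comm, ← hf0 n]
          refine (hf n 0 t le_rfl ht.1 ht.2).trans ?_
          have : 1 / ((n : ℝ) + 1) ≤ 1 := by
            rw [div_le_one (by positivity)]
            linarith [n.cast_nonneg (α := ℝ)]
          linarith [ht.2])
      exact ⟨a, fun _ => ha⟩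
    · exact ⟨y, fun h => absurd h ht⟩
  choose g hg using hg
  have hlip : ∀ s ∈ Icc 0 L, ∀ t ∈ Icc 0 L, s ≤ t → dist (g s) (g t) ≤ t - s := by
    intro s hs t ht hst
    have h1 : Tendsto (fun n : ℕ => t - s + 1 / ((n : ℝ) + 1)) U (𝓝 (t - s)) := by
      have := tendsto_one_div_add_atTop_nhds_zero_nat (𝕜 := ℝ)
      simpa using (this.mono_left hU).const_add (t - s)
    exact le_of_tendsto_of_tendsto' ((hg s hs).dist (hg t ht)) h1
      fun n => hf n s t hs.1 hst ht.2
  have hg0 : g 0 = y := by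
    refine tendsto_nhds_unique (hg 0 (left_mem_Icc.2 hL)) ?_
    simp only [hf0]
    exact tendsto_const_nhds
  have hgL : g L = z := by
    refine tendsto_nhds_unique (hg L (right_mem_Icc.2 hL)) ?_
    simp only [hfL]
    exact tendsto_const_nhds
  have hmem : ∀ t ∈ Icc (0 : ℝ) 1, t * L ∈ Icc 0 L := fun t ht =>
    ⟨mul_nonneg ht.1 hL, mul_le_of_le_one_left hL ht.2⟩
  have hcont : ContinuousOn g (Icc 0 L) := by
    refine LipschitzOnWith.continuousOn (K := 1) (LipschitzOnWith.of_dist_le_mul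
      fun s hs t ht => ?_)
    rw [NNReal.coe_one, one_mul, Real.dist_eq]
    rcases le_total s t with hst | hst
    · rw [abs_sub_comm, abs_of_nonneg (sub_nonneg.2 hst)]
      exact hlip s hs t ht hst
    · rw [abs_of_nonneg (sub_nonneg.2 hst), dist_comm]
      exact hlip t ht s hs hst
  refine JoinedIn.ofLine (f := fun t => g (t * L)) ?_ (by simp [hg0]) (by simp [hgL]) ?_
  · exact hcont.comp (continuous_id.mul continuous_const).continuousOn hmem
  · rintro _ ⟨t, ht, rfl⟩
    have := hlip 0 (left_mem_Icc.2 hL) (t * L) (hmem t ht) (hmem t ht).1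
    rw [hg0] at this
    rw [Metric.mem_closedBall, dist_comm]
    linarith [(hmem t ht).2]

variable [MeasurableSpace X] [BorelSpace X]

/-- A proper space with a doubling measure and a Poincaré inequality is locally path connected
(in fact quasiconvex). -/
theorem SupportsPoincare.locallyPathConnectedSpace [ProperSpace X] {μ : Measure X} {p : ℝ}
    (hp : 0 < p) (hP : SupportsPoincare μ p) (hd : IsDoubling μ)
    (hμ : ∀ (x : X) (r : ℝ), 0 < r → 0 < μ (Metric.ball x r) ∧ μ (Metric.ball x r) < ⊤) :
    LocallyPathConnectedSpace X := by
  obtain ⟨K, hK, hKv⟩ := hP.exists_lipschitz_const hp hd hμ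
  have hjoin : ∀ y z : X, JoinedIn (Metric.closedBall y ((K + 1) * dist y z)) y z := by
    intro y z
    rcases eq_or_ne y z with rfl | hne
    · exact JoinedIn.refl (by simp)
    have hD : 0 < dist y z := dist_pos.2 hne
    refine joinedIn_of_hasDiscreteCurve (by positivity) fun ε hε => ?_
    -- With this `N` the cutoff at `z` is `(K + 1) * d(y, z) > K * d(y, z)`, so the Lipschitz bound
    -- must come from the discrete distance.
    set N := (K + 2) * dist y z with hN
    have hN0 : 0 < N := by positivity
    have h := hKv y N ε _ hN0 hε (isTestFunction_discreteDist hN0.le y) z y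
    rw [discreteDist_self hε.le hN0.le, min_eq_left (a := (0 : ℝ)) (le_max_left _ _), sub_zero,
      dist_comm z y] at h
    have h1 := (le_abs_self _).trans h
    have h2 : discreteDist ε N y z < (K + 1) * dist y z := by
      by_contra! hcon
      have : (K + 1) * dist y z ≤ max 0 (N - dist y z) :=
        le_max_of_le_right (by rw [hN]; linarith)
      linarith [le_min hcon this]
    obtain ⟨l, hl, hl'⟩ := exists_hasDiscreteCurve h2 (by rw [hN]; linarith)
    exact ⟨l, hl.le, hl'⟩
  rw [locallyPathConnectedSpace_iff_pathComponentIn_mem_nhds]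
  intro x u hu hxu
  obtain ⟨r, hr, hru⟩ := Metric.isOpen_iff.1 hu x hxu
  refine Filter.mem_of_superset (Metric.ball_mem_nhds x (ε := r / (K + 1)) (by positivity))
    fun z hz => ?_
  refine (hjoin x z).mono ((Metric.closedBall_subset_ball ?_).trans hru)
  rw [Metric.mem_ball, dist_comm, lt_div_iff₀ (by positivity)] at hz
  linarith

end DiscreteCurves

/-! ### Chains with singleton impression and accessible points -/

section Ends

variable {X : Type*} [MetricSpace X] {Ω : Set X}

/-- Off `frontier A` the space splits into the disjoint open sets `interior A` and `(closure A)ᶜ`.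
-/
theorem inter_frontier_nonempty_of_isPreconnected {S A : Set X} (hS : IsPreconnected S)
    (hSA : (S ∩ A).Nonempty) (hnot : ¬ S ⊆ A) : (S ∩ frontier A).Nonempty := by
  by_contra hcon
  have hsub : S ⊆ interior A ∪ (closure A)ᶜ := fun y hy => by
    by_contra h
    rw [mem_union, not_or, mem_compl_iff, not_not] at h
    exact hcon ⟨y, hy, h.2, h.1⟩
  rcases hS.subset_or_subset isOpen_interior isClosed_closure.isOpen_compl
    (disjoint_compl_right_iff_subset.2 interior_subset_closure) hsub with h | h
  · exact hnot (h.trans interior_subset)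
  · obtain ⟨y, hyS, hyA⟩ := hSA
    exact h hyS (subset_closure hyA)

namespace Chain

theorem antitone_sets (E : Chain Ω) : Antitone E.sets := antitone_nat_of_succ_le E.subset

theorem exists_subset_ball [ProperSpace X] (E : Chain Ω) {x : X} (hE : E.impression = {x})
    {r : ℝ} (hr : 0 < r) : ∃ k, E.sets k ⊆ Metric.ball x r := by
  obtain ⟨k, hk⟩ := exists_subset_nhds_of_isCompact' (V := fun k => closure (E.sets k))
    (Antitone.directed_ge fun m n h => closure_mono (E.antitone_sets h))
    (fun k => (E.acceptable k).bounded.isCompact_closure) (fun _ => isClosed_closure)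
    (U := Metric.ball x r) (fun y hy => by
      have : y ∈ E.impression := hy
      rw [hE, mem_singleton_iff] at this
      rw [this]
      exact Metric.ball_mem_nhds x hr)
  exact ⟨k, subset_closure.trans hk⟩

/-- If no `E_l` lies in `F_k`, then each `E_l` leaves `F_k` while meeting `F_{k+1}`, because it
contains some `F_m`. Being connected, it meets both boundaries, which is impossible once its
diameter is below their distance. -/
theorem divides_of_impression_eq_singleton [ProperSpace X] {E F : Chain Ω} {x : X}
    (hE : E.impression = {x}) (h : F.Divides E) : E.Divides F := by
  intro k
  by_contra! hcon
  obtain ⟨r, hr, hrlt⟩ := ENNReal.lt_iff_exists_nnreal_btwn.1 (F.dist_pos k)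
  have hr' : (0 : ℝ) < r / 2 := by
    have : 0 < r := ENNReal.coe_pos.1 hr
    positivity
  obtain ⟨l, hl⟩ := E.exists_subset_ball hE hr'
  obtain ⟨m, hm⟩ := h l
  have hconn := (E.acceptable l).connected.isPreconnected
  obtain ⟨y, hy⟩ := (F.acceptable (max m (k + 1))).connected.nonempty
  have hyE : y ∈ E.sets l := hm (F.antitone_sets (le_max_left _ _) hy)
  have hyF : y ∈ F.sets (k + 1) := F.antitone_sets (le_max_right _ _) hy
  obtain ⟨a, haE, ha⟩ := inter_frontier_nonempty_of_isPreconnected (A := F.sets (k + 1)) hconn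
    ⟨y, hyE, hyF⟩ fun h => hcon l (h.trans (F.subset k))
  obtain ⟨b, hbE, hb⟩ := inter_frontier_nonempty_of_isPreconnected (A := F.sets k) hconn
    ⟨y, hyE, F.subset k hyF⟩ (hcon l)
  have hΩ := (E.acceptable l).ssubset.subset
  have h1 : setDist (Ω ∩ frontier (F.sets (k + 1))) (Ω ∩ frontier (F.sets k)) ≤ edist a b :=
    iInf₂_le_of_le a ⟨hΩ haE, ha⟩ (iInf₂_le b ⟨hΩ hbE, hb⟩)
  refine absurd (hrlt.trans_le h1) (not_lt.2 ?_)
  rw [edist_dist, ← ENNReal.ofReal_coe_nnreal]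
  refine ENNReal.ofReal_le_ofReal ?_
  have := dist_triangle_right a b x
  linarith [Metric.mem_ball.1 (hl haE), Metric.mem_ball.1 (hl hbE)]

/-- A chain with a singleton impression `{x}` is a `Mod_p`-chain, if `p ∈ Q(x)` and
`Q(x) ≠ (0, 1]`. -/
theorem isModChain_of_impression_eq_singleton [ProperSpace X] [MeasurableSpace X] [BorelSpace X]
    {μ : Measure X} {x : X} (hx : x ∉ Ω)
    (hμ : ∀ r : ℝ, 0 < r → 0 < μ (Metric.ball x r) ∧ μ (Metric.ball x r) < ⊤)
    {p : ℝ} (hp : 1 ≤ p) (hpQ : p ∈ dimSet μ x) (hne : dimSet μ x ≠ Ioc 0 1)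
    {E : Chain Ω} (hE : E.impression = {x}) : E.IsModChain μ p := by
  intro K hK hKΩ
  obtain ⟨R, hR, hRK⟩ := Metric.isOpen_iff.1 hK.isClosed.isOpen_compl x fun h => hx (hKΩ h)
  refine ENNReal.tendsto_nhds_zero.2 fun ε hε => ?_
  obtain ⟨η, hη, hηε⟩ := ENNReal.lt_iff_exists_nnreal_btwn.1 hε
  obtain ⟨s, hs, hmod⟩ := exists_modulus_le hμ hp hpQ hne hR (ε := η) (by exact_mod_cast hη)
  obtain ⟨k, hk⟩ := E.exists_subset_ball hE hs
  filter_upwards [eventually_ge_atTop k] with m hm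
  refine (hmod _ fun γ hγ => ⟨?_, ?_⟩).trans (by simpa using hηε.le)
  · exact (hk (E.antitone_sets hm hγ.1)).le
  · by_contra! hlt
    exact hRK hlt hγ.2.1

end Chain

theorem End.isPrime_of_impression_eq_singleton [ProperSpace X] {e : End Ω} {x : X}
    (he : e.impression = {x}) : e.IsPrime := by
  induction e using Quotient.inductionOn with
  | h E =>
    intro f hf
    induction f using Quotient.inductionOn with
    | h F => exact Quotient.sound ⟨hf, Chain.divides_of_impression_eq_singleton he hf⟩

/-- A frontier point in `Ω` with distance below `r` has an open component of its own in `Ω ∩ B(x,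
r)`. That component meets the given one, hence equals it, but an open set contains no frontier point
of itself. This separates the boundaries of the chain built from an accessible point. -/
theorem frontier_component_subset [LocallyConnectedSpace X] (hΩ : IsOpen Ω) {x y : X} {r : ℝ} :
    Ω ∩ frontier (connectedComponentIn (Ω ∩ Metric.ball x r) y) ⊆ {z | dist z x = r} := by
  have hopen : IsOpen (Ω ∩ Metric.ball x r) := hΩ.inter Metric.isOpen_ball
  rintro z ⟨hzΩ, hz⟩
  have hle : dist z x ≤ r := by
    have : closure (connectedComponentIn (Ω ∩ Metric.ball x r) y) ⊆ Metric.closedBall x r :=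
      closure_minimal (((connectedComponentIn_subset _ _).trans inter_subset_right).trans
        Metric.ball_subset_closedBall) Metric.isClosed_closedBall
    exact this hz.1
  refine hle.eq_of_not_lt fun hlt => ?_
  have hzF : z ∈ Ω ∩ Metric.ball x r := ⟨hzΩ, hlt⟩
  obtain ⟨w, hwz, hwy⟩ := mem_closure_iff.1 hz.1 _
    (hopen.connectedComponentIn (x := z)) (mem_connectedComponentIn hzF)
  have h1 := connectedComponentIn_eq hwz
  have h2 := connectedComponentIn_eq hwy
  refine hz.2 ?_
  rw [hopen.connectedComponentIn.interior_eq, h2, ← h1]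
  exact mem_connectedComponentIn hzF

/-- An accessible boundary point is the impression of a chain. -/
theorem IsAccessible.exists_chain [LocallyConnectedSpace X] (hΩ : IsOpen Ω) {x : X}
    (hx : x ∈ frontier Ω) (hacc : IsAccessible Ω x) : ∃ E : Chain Ω, E.impression = {x} := by
  obtain ⟨γ, hγ, hγ1, hγΩ⟩ := hacc
  have hxΩ : x ∉ Ω := fun h => hx.2 (by rwa [hΩ.interior_eq])
  have h0 : γ 0 ∈ Ω := hγΩ 0 (by simp)
  set r₀ := dist (γ 0) x with hr₀
  have hr₀pos : 0 < r₀ := dist_pos.2 fun h => hxΩ (h ▸ h0)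
  -- Starting at `r₀ = d(γ 0, x)` keeps `γ 0` outside every ball, so each component is a proper
  -- subset of `Ω`.
  let r : ℕ → ℝ := fun k => r₀ / 2 ^ k
  have hr : ∀ k, 0 < r k := fun k => by positivity
  have hr_succ : ∀ k, r (k + 1) < r k := fun k => by
    have h : r (k + 1) = r k / 2 := by simp only [r, pow_succ]; field_simp
    rw [h]
    exact half_lt_self (hr k)
  have hr_lim : Tendsto r atTop (𝓝 0) := tendsto_const_nhds.div_atTop
    (tendsto_pow_atTop_atTop_of_one_lt one_lt_two)
  have hclose : ∀ ε > 0, ∃ t ∈ Ico (0 : ℝ) 1, ∀ s ∈ Ico t 1, γ s ∈ Metric.ball x ε := by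
    intro ε hε
    obtain ⟨δ, hδ, h⟩ := Metric.continuousWithinAt_iff.1 (hγ 1 (by simp)) ε hε
    refine ⟨max 0 (1 - δ / 2), ⟨le_max_left _ _, max_lt one_pos (by linarith)⟩,
      fun s hs => ?_⟩
    have hs0 : 0 ≤ s := (le_max_left _ _).trans hs.1
    have hsδ : 1 - δ / 2 ≤ s := (le_max_right _ _).trans hs.1
    have := h ⟨hs0, hs.2.le⟩ (by
      rw [Real.dist_eq, abs_sub_comm, abs_of_pos (by linarith [hs.2])]
      linarith)
    rwa [hγ1] at this
  choose t ht hball using fun k => hclose (r k) (hr k)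
  let E : ℕ → Set X := fun k => connectedComponentIn (Ω ∩ Metric.ball x (r k)) (γ (t k))
  have hEsub : ∀ k, E k ⊆ Ω ∩ Metric.ball x (r k) := fun k => connectedComponentIn_subset _ _
  have hγE : ∀ k, ∀ s ∈ Ico (t k) 1, γ s ∈ E k := by
    intro k s hs
    have hpre : IsPreconnected (γ '' Ico (t k) 1) := isPreconnected_Ico.image γ
      (hγ.mono (Ico_subset_Icc_self.trans (Icc_subset_Icc_left (ht k).1)))
    refine hpre.subset_connectedComponentIn (mem_image_of_mem γ (left_mem_Ico.2 (ht k).2)) ?_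
      (mem_image_of_mem γ hs)
    rintro _ ⟨s, hs, rfl⟩
    exact ⟨hγΩ s ⟨(ht k).1.trans hs.1, hs.2⟩, hball k s hs⟩
  have hxcl : ∀ k, x ∈ closure (E k) := by
    intro k
    refine Metric.mem_closure_iff.2 fun ε hε => ?_
    obtain ⟨t', ht', h'⟩ := hclose ε hε
    have hmax : max (t k) t' < 1 := max_lt (ht k).2 ht'.2
    refine ⟨γ (max (t k) t'), hγE k _ ⟨le_max_left _ _, hmax⟩, ?_⟩
    rw [dist_comm]
    exact h' _ ⟨le_max_right _ _, hmax⟩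
  have himp : ⋂ k, closure (E k) = {x} := by
    refine Subset.antisymm (fun z hz => ?_) (singleton_subset_iff.2 (mem_iInter.2 hxcl))
    have : ∀ k, dist z x ≤ r k := fun k =>
      closure_minimal (((hEsub k).trans inter_subset_right).trans
        Metric.ball_subset_closedBall) Metric.isClosed_closedBall (mem_iInter.1 hz k)
    have := ge_of_tendsto' hr_lim this
    exact dist_le_zero.1 this
  refine ⟨⟨E, fun k => ⟨?_, ?_, ?_, x, hxcl k, hx⟩, fun k => ?_, fun k => ?_, ?_⟩, himp⟩
  · exact Metric.isBounded_ball.subset ((hEsub k).trans inter_subset_right)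
  · exact isConnected_connectedComponentIn_iff.2
      ((hEsub k) (hγE k _ (left_mem_Ico.2 (ht k).2)))
  · refine ssubset_of_subset_not_subset ((hEsub k).trans inter_subset_left) fun h => ?_
    have h1 := (hEsub k (h h0)).2
    rw [Metric.mem_ball, ← hr₀] at h1
    exact absurd h1 (not_lt.2 (div_le_self hr₀pos.le (one_le_pow₀ one_le_two)))
  -- A common point of the two tails serves as base point of both components, which makes them
  -- nested.
  · have hmax : max (t k) (t (k + 1)) < 1 := max_lt (ht k).2 (ht (k + 1)).2
    have h1 := connectedComponentIn_eq (hγE k _ ⟨le_max_left _ _, hmax⟩)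
    have h2 := connectedComponentIn_eq (hγE (k + 1) _ ⟨le_max_right _ _, hmax⟩)
    change connectedComponentIn _ _ ⊆ connectedComponentIn _ _
    rw [h1, h2]
    exact connectedComponentIn_mono _
      (inter_subset_inter_right _ (Metric.ball_subset_ball (hr_succ k).le))
  · refine lt_of_lt_of_le (b := ENNReal.ofReal (r k - r (k + 1)))
      (ENNReal.ofReal_pos.2 (sub_pos.2 (hr_succ k)))
      (le_iInf₂ fun a ha => le_iInf₂ fun b hb => ?_)
    have ha' : dist a x = r (k + 1) := frontier_component_subset hΩ ha
    have hb' : dist b x = r k := frontier_component_subset hΩ hb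
    rw [edist_dist]
    refine ENNReal.ofReal_le_ofReal ?_
    have := dist_triangle_left b x a
    linarith
  · rw [himp]
    exact singleton_subset_iff.2 hx

/-- Infinitely many paths can be concatenated. -/
theorem exists_continuous_of_joinedIn {Y : Type*} [TopologicalSpace Y] {S : ℕ → Set Y} {a : ℕ → Y}
    (h : ∀ n, JoinedIn (S n) (a n) (a (n + 1))) :
    ∃ g : ℝ → Y, ContinuousOn g (Ici 0) ∧ ∀ t, 0 ≤ t → g t ∈ S ⌊t⌋₊ := by
  choose P hP using h
  let g : ℝ → Y := fun t => (P ⌊t⌋₊).extend (t - ⌊t⌋₊)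
  have hfloor : ∀ (n : ℕ) (t : ℝ), ⌊t⌋₊ = n → g t = (P n).extend (t - n) := by
    rintro _ t rfl
    rfl
  have hg : ∀ n : ℕ, ∀ t ∈ Icc (n : ℝ) (n + 1), g t = (P n).extend (t - n) := by
    intro n t ht
    -- At `t = n + 1` the floor already selects the next path, but both paths take the value `a (n +
    -- 1)` there.
    rcases ht.2.eq_or_lt with h1 | h1
    · have : ⌊t⌋₊ = n + 1 := by
        rw [h1]
        exact_mod_cast Nat.floor_natCast (R := ℝ) (n + 1)
      rw [hfloor _ _ this, h1]
      simp
    · have : ⌊t⌋₊ = n := (Nat.floor_eq_iff ((Nat.cast_nonneg n).trans ht.1)).2 ⟨ht.1, h1⟩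
      exact hfloor _ _ this
  have hcont : ∀ n : ℕ, ContinuousOn g (Icc (0 : ℝ) n) := by
    intro n
    induction n with
    | zero => simp
    | succ n ih =>
      have h1 : ContinuousOn g (Icc (n : ℝ) (n + 1)) :=
        ((P n).continuous_extend.comp (continuous_id.sub continuous_const)).continuousOn.congr
          (hg n)
      have h2 := ih.union_of_isClosed h1 isClosed_Icc isClosed_Icc
      rw [Icc_union_Icc_eq_Icc n.cast_nonneg (by linarith)] at h2
      exact_mod_cast h2
  refine ⟨g, fun t ht => ?_, fun t ht => ?_⟩
  · obtain ⟨n, hn⟩ := exists_nat_gt t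
    refine ((hcont n) t ⟨ht, hn.le⟩).mono_of_mem_nhdsWithin ?_
    rw [← Ici_inter_Iic]
    exact inter_mem self_mem_nhdsWithin (mem_nhdsWithin_of_mem_nhds (Iic_mem_nhds hn))
  · have hmem : t - ⌊t⌋₊ ∈ Icc (0 : ℝ) 1 :=
      ⟨sub_nonneg.2 (Nat.floor_le ht), by linarith [Nat.lt_floor_add_one t]⟩
    simp only [g]
    rw [Path.extend_apply _ hmem]
    exact hP _ _

/-- A point which is the impression of a chain is accessible. -/
theorem Chain.isAccessible [ProperSpace X] [LocallyPathConnectedSpace X] (hΩ : IsOpen Ω)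
    {E : Chain Ω} {x : X} (hE : E.impression = {x}) : IsAccessible Ω x := by
  choose k hk using fun n : ℕ =>
    E.exists_subset_ball hE (r := 1 / ((n : ℝ) + 1)) (by positivity)
  -- Partial sums give a monotone sequence of indices above `k`.
  let m : ℕ → ℕ := fun n => ∑ i ∈ Finset.range (n + 1), k i
  have hkm : ∀ n, k n ≤ m n := fun n =>
    Finset.single_le_sum (f := k) (fun _ _ => Nat.zero_le _) (Finset.self_mem_range_succ n)
  have hm : ∀ n, m n ≤ m (n + 1) := fun n =>
    Finset.sum_le_sum_of_subset (Finset.range_mono (by omega))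
  have hsub : ∀ n, E.sets (m n) ⊆ Ω ∩ Metric.ball x (1 / ((n : ℝ) + 1)) := fun n =>
    subset_inter (E.acceptable _).ssubset.subset
      ((E.antitone_sets (hkm n)).trans (hk n))
  choose a ha using fun n => (E.acceptable (m n)).connected.nonempty
  have hjoin : ∀ n : ℕ, JoinedIn (Ω ∩ Metric.ball x (1 / ((n : ℝ) + 1))) (a n) (a (n + 1)) := by
    intro n
    have hopen : IsOpen (Ω ∩ Metric.ball x (1 / ((n : ℝ) + 1))) := hΩ.inter Metric.isOpen_ball
    -- The chain set need not be path connected, but the open component containing it is.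
    have hpc := (hopen.connectedComponentIn (x := a n)).isConnected_iff_isPathConnected.1
      (isConnected_connectedComponentIn_iff.2 (hsub n (ha n)))
    have hEc := (E.acceptable (m n)).connected.isPreconnected.subset_connectedComponentIn
      (ha n) (hsub n)
    exact (hpc.joinedIn _ (hEc (ha n)) _ (hEc (E.antitone_sets (hm n) (ha (n + 1))))).mono
      (connectedComponentIn_subset _ _)
  obtain ⟨g, hg, hgS⟩ := exists_continuous_of_joinedIn hjoin
  have hnonneg : ∀ t ∈ Ico (0 : ℝ) 1, 0 ≤ t / (1 - t) := fun t ht =>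
    div_nonneg ht.1 (by linarith [ht.2])
  -- The map `t ↦ t / (1 - t)` carries `[0, 1)` onto `[0, ∞)`; if `1 - s < 1 / (n + 1)`, then `s /
  -- (1 - s) ≥ n`.
  let γ : ℝ → X := fun t => if t < 1 then g (t / (1 - t)) else x
  have hγ : ∀ t < 1, γ t = g (t / (1 - t)) := fun t ht => if_pos ht
  have hγ1 : γ 1 = x := if_neg (lt_irrefl 1)
  refine ⟨γ, fun t ht => ?_, hγ1, fun t ht => ?_⟩
  · rcases ht.2.eq_or_lt with rfl | ht1
    · refine Metric.continuousWithinAt_iff.2 fun ε hε => ?_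
      obtain ⟨n, hn⟩ := exists_nat_one_div_lt hε
      refine ⟨1 / ((n : ℝ) + 1), by positivity, fun s hs hsd => ?_⟩
      rw [hγ1]
      rcases hs.2.eq_or_lt with rfl | hs1
      · rw [hγ1, dist_self]
        exact hε
      · rw [hγ s hs1]
        have h1s : 0 < 1 - s := by linarith
        rw [Real.dist_eq, abs_sub_comm, abs_of_pos h1s, lt_div_iff₀ (by positivity)] at hsd
        have hfl : n ≤ ⌊s / (1 - s)⌋₊ := by
          refine Nat.le_floor ?_
          rw [le_div_iff₀ h1s]
          linarith
        refine lt_trans (hgS _ (hnonneg s ⟨hs.1, hs1⟩)).2 (lt_of_le_of_lt ?_ hn)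
        exact one_div_le_one_div_of_le (by positivity) (by exact_mod_cast Nat.succ_le_succ hfl)
    · have hc : ContinuousWithinAt (fun t => g (t / (1 - t))) (Ico 0 1) t := by
        refine ContinuousWithinAt.comp (t := Ici 0) (hg _ (hnonneg t ⟨ht.1, ht1⟩)) ?_ hnonneg
        exact ContinuousAt.continuousWithinAt (by fun_prop (disch := linarith))
      have hc' : ContinuousWithinAt γ (Ico 0 1) t :=
        hc.congr (fun s hs => hγ s hs.2) (hγ t ht1)
      refine hc'.mono_of_mem_nhdsWithin ?_
      filter_upwards [self_mem_nhdsWithin, mem_nhdsWithin_of_mem_nhds (Iio_mem_nhds ht1)]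
        with s hs hs1 using ⟨hs.1, hs1⟩
  · rw [hγ t ht.2]
    exact (hgS _ (hnonneg t ht)).1

end Ends

end PrimeEnds

/-! ### The equivalences -/

theorem mainTheorem8 {X : Type*} [MetricSpace X] [CompleteSpace X] [MeasurableSpace X]
    [BorelSpace X] (μ : Measure X)
    (hμ : ∀ (x : X) (r : ℝ), 0 < r → 0 < μ (Metric.ball x r) ∧ μ (Metric.ball x r) < ⊤)
    (hdoubling : PrimeEnds.IsDoubling μ)
    (p : ℝ) (hp : 1 ≤ p) (hPoincare : PrimeEnds.SupportsPoincare μ p)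
    (Ω : Set X) (hopen : IsOpen Ω) (hconn : IsConnected Ω) (hbdd : Bornology.IsBounded Ω)
    (hne : Ω ≠ Set.univ)
    (x : X) (hx : x ∈ frontier Ω) :
    [ PrimeEnds.IsAccessible Ω x,
      ∃ e : PrimeEnds.End Ω, e.impression = {x},
      ∃ e : PrimeEnds.End Ω, e.IsPrime ∧ e.impression = {x} ].TFAE ∧
    (p ∈ PrimeEnds.dimSet μ x → PrimeEnds.dimSet μ x ≠ Set.Ioc 0 1 →
      [ PrimeEnds.IsAccessible Ω x,
        ∃ e : PrimeEnds.End Ω, e.impression = {x},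
        ∃ e : PrimeEnds.End Ω, e.IsPrime ∧ e.impression = {x},
        ∃ e : PrimeEnds.End Ω, e.IsModEnd μ p ∧ e.impression = {x},
        ∃ e : PrimeEnds.End Ω, e.IsModPrime μ p ∧ e.impression = {x} ].TFAE) := by
  have : ProperSpace X := hdoubling.properSpace hμ
  have : LocallyPathConnectedSpace X :=
    hPoincare.locallyPathConnectedSpace (by linarith) hdoubling hμ
  have h12 : PrimeEnds.IsAccessible Ω x → ∃ e : PrimeEnds.End Ω, e.impression = {x} := by
    intro h
    obtain ⟨E, hE⟩ := h.exists_chain hopen hx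
    exact ⟨Quotient.mk _ E, hE⟩
  have h21 : (∃ e : PrimeEnds.End Ω, e.impression = {x}) → PrimeEnds.IsAccessible Ω x := by
    rintro ⟨e, he⟩
    induction e using Quotient.inductionOn with
    | h E => exact PrimeEnds.Chain.isAccessible hopen he
  have h23 : (∃ e : PrimeEnds.End Ω, e.impression = {x}) →
      ∃ e : PrimeEnds.End Ω, e.IsPrime ∧ e.impression = {x} :=
    fun ⟨e, he⟩ => ⟨e, PrimeEnds.End.isPrime_of_impression_eq_singleton he, he⟩
  have h32 : (∃ e : PrimeEnds.End Ω, e.IsPrime ∧ e.impression = {x}) →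
      ∃ e : PrimeEnds.End Ω, e.impression = {x} := fun ⟨e, _, he⟩ => ⟨e, he⟩
  refine ⟨?_, fun hpQ hQ => ?_⟩
  · tfae_have 1 → 2 := h12
    tfae_have 2 → 1 := h21
    tfae_have 2 → 3 := h23
    tfae_have 3 → 2 := h32
    tfae_finish
  · have hxΩ : x ∉ Ω := fun h => hx.2 (by rwa [hopen.interior_eq])
    tfae_have 1 → 2 := h12
    tfae_have 2 → 1 := h21
    tfae_have 2 → 3 := h23
    tfae_have 3 → 2 := h32
    -- Being indivisible among all ends implies being indivisible among `Mod_p`-ends.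
    tfae_have 2 → 5 := by
      rintro ⟨e, he⟩
      refine ⟨e, ⟨?_, fun f _ hf => PrimeEnds.End.isPrime_of_impression_eq_singleton he f hf⟩, he⟩
      induction e using Quotient.inductionOn with
      | h E =>
        exact ⟨E, PrimeEnds.Chain.isModChain_of_impression_eq_singleton hxΩ (hμ x) hp hpQ hQ he,
          rfl⟩
    tfae_have 5 → 4 := fun ⟨e, h, he⟩ => ⟨e, h.1, he⟩
    tfae_have 4 → 2 := fun ⟨e, _, he⟩ => ⟨e, he⟩
    tfae_finish
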